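/- **Theorem 1.3.** Let $\mathbb H=\{x+iy:y>0\}$ carry the hyperbolic metric, let $T^1\mathbb H$ be its unit tangent bundle, let $M=\mathrm{PSL}(2,\mathbb Z)\backslash\mathbb H$ and $T^1M=\mathrm{PSL}(2,\mathbb Z)\backslash T^1\mathbb H$, and let $g_t$ be the geodesic flow on $T^1M$. For $d>1$ let $\overline M_d\subset T^1M$ be the image of the set of unit tangent vectors with base point in $\{\operatorname{Im} z>d\}$, and let $\chi_{\overline M_d}$ be its characteristic function. The forward orbit $\{g_tv\}_{t\ge0}$ of $v\in T^1M$ *visits the cusp with frequency $0$* if $\frac1T\int_0^T\chi_{\overline M_d}(g_tv)\,dt\to0$ as $T\to\infty$ for some $d>1$, and *visits the cusp with frequency $1$* if $\frac1T\int_0^T\chi_{\overline M_d}(g_tv)\,dt\to1$ as $T\to\infty$ for every $d>1$. Let $-1\le a<0<b\le1$ with $b-a\ge1$. Put $[x]_{a,b}=\lfloor x-a\rfloor$ if $x<a$, $[x]_{a,b}=0$ if $a\le x<b$, and $[x]_{a,b}=\lfloor x-b\rfloor+1$ if $x\ge b$. The $(a,b)$-continued fraction expansion $x=[a_0,a_1,a_2,\dots]_{a,b}$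 of an irrational $x$ is given by $x_0=x$, $a_j=[x_j]_{a,b}$, $x_{j+1}=-1/(x_j-a_j)$. Let $f_{a,b}:\mathbb R\cup\{\infty\}\to\mathbb R\cup\{\infty\}$ be $y\mapsto y+1$ for $y<a$, $y\mapsto-1/y$ for $a\le y<b$ (with $0\mapsto\infty$), $y\mapsto y-1$ for $y\ge b$, and $\infty\mapsto\infty$. Let $\mathcal S$ be the set of such pairs $(a,b)$ that satisfy the finiteness condition: the $f_{a,b}$-orbits of $-1/a$ and $a+1$ are both eventually periodic or they meet (i.e. $f_{a,b}^{m}(-1/a)=f_{a,b}^{k}(a+1)$ for some $m,k\ge0$), and likewise for the orbits of $b-1$ and $-1/b$. Let $(a,b)\in\mathcal S$, let $v\in T^1M$, let $\gamma_v$ be the corresponding geodesic in $M$, and let $x$ be the attracting endpoint of a lift of $\gamma_v$ to $\mathbb H$; assume that $x$ is irrational, and let $x=[a_0,a_1,a_2,\dots]_{a,b}$. For $\xi>1$ put $a_j^\xi=a_j$ if $|a_j|>\xi$ and $a_j^\xi=1$ if $|a_j|\le\xi$. Then 1. $\{g_tv\}_{t\ge0}$ visits the cusp with frequency $0$ if and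 only if $\frac1N\sum_{j=0}^{N-1}\log|a_j^\xi|\to0$ as $N\to\infty$ for some $\xi>1$; 2. $\{g_tv\}_{t\ge0}$ visits the cusp with frequency $1$ if and only if $\frac1N\sum_{j=0}^{N-1}\log|a_j|\to\infty$ as $N\to\infty$, where a possible initial term with $a_0=0$ is counted as $0$. -/

import Mathlib

noncomputable section

open Filter Topology
open scoped UpperHalfPlane MatrixGroups ComplexConjugate

namespace CuspExcursion

/-! ### The unit tangent bundle of the hyperbolic plane and of the modular surface -/

/-- A point of the unit tangent bundle `T¹ℍ`: a base point `z` of the upper half plane and a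
tangent vector `ζ` at `z` (a complex number) of length one for the metric
`(dx² + dy²) / y²`, i.e. with `|ζ| = Im z`. -/
@[ext]
structure T1H where
  base : ℍ
  dir : ℂ
  norm_dir : ‖dir‖ = base.im

/-- The factor `c z + d` of a matrix `(a b; c d)` of `SL(2,ℤ)`. -/
def factor (g : SL(2, ℤ)) (z : ℂ) : ℂ := ((g 1 0 : ℤ) : ℂ) * z + ((g 1 1 : ℤ) : ℂ)

theorem factor_ne_zero (g : SL(2, ℤ)) (z : ℍ) : factor g z ≠ 0 := by
  have h := UpperHalfPlane.denom_ne_zero (g : GL (Fin 2) ℝ) z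
  rwa [ModularGroup.denom_apply] at h

theorem factor_mul (g h : SL(2, ℤ)) (z : ℍ) :
    factor (g * h) z = factor g ↑(h • z) * factor h z := by
  have hh := factor_ne_zero h z
  have key : ((h • z : ℍ) : ℂ) =
      (((h 0 0 : ℤ) : ℂ) * z + ((h 0 1 : ℤ) : ℂ)) / factor h z := by
    rw [UpperHalfPlane.coe_specialLinearGroup_apply]; simp [factor]
  rw [key, factor, factor]
  have e : ∀ p q n D : ℂ, D ≠ 0 → (p * (n / D) + q) * D = p * n + q * D := by
    intro p q n D hD
    field_simp
  rw [e _ _ _ _ hh, factor]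
  simp only [Matrix.SpecialLinearGroup.coe_mul, Matrix.mul_apply, Fin.sum_univ_two]
  push_cast
  ring

theorem coe_smul_eq (g : SL(2, ℤ)) (z : ℍ) : ((g • z : ℍ) : ℂ) =
    (((g 0 0 : ℤ) : ℂ) * z + ((g 0 1 : ℤ) : ℂ)) / factor g z := by
  rw [UpperHalfPlane.coe_specialLinearGroup_apply]; simp [factor]

theorem im_smul_eq (g : SL(2, ℤ)) (z : ℍ) :
    (g • z).im = z.im / ‖factor g z‖ ^ 2 := by
  rw [ModularGroup.im_smul_eq_div_normSq, Complex.normSq_eq_norm_sq, ModularGroup.denom_apply]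
  rfl

/-- `SL(2,ℤ)` acts on `T¹ℍ` by Möbius transformations and their derivatives
`(z, ζ) ↦ (g z, ζ / (c z + d)²)`; the action factors through `PSL(2,ℤ)`. -/
instance : MulAction SL(2, ℤ) T1H where
  smul g v := ⟨g • v.base, v.dir / factor g v.base ^ 2, by
    rw [norm_div, norm_pow, v.norm_dir, im_smul_eq]⟩
  one_smul v := by
    refine T1H.ext (one_smul _ _) ?_
    change v.dir / factor 1 v.base ^ 2 = v.dir
    simp [factor]
  mul_smul g h v := by
    refine T1H.ext (mul_smul _ _ _) ?_
    change v.dir / factor (g * h) v.base ^ 2 =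
      v.dir / factor h v.base ^ 2 / factor g ↑(h • v.base) ^ 2
    rw [factor_mul, div_div, ← mul_pow, mul_comm]

theorem smul_base (g : SL(2, ℤ)) (v : T1H) : (g • v).base = g • v.base := rfl

theorem smul_dir (g : SL(2, ℤ)) (v : T1H) : (g • v).dir = v.dir / factor g v.base ^ 2 := rfl

/-- The unit tangent bundle `T¹M` of the modular surface `M = PSL(2,ℤ) \ ℍ`, as the quotient of
`T¹ℍ` by `PSL(2,ℤ)` (equivalently, by `SL(2,ℤ)`). -/
def T1M : Type := MulAction.orbitRel.Quotient SL(2, ℤ) T1H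

/-- The projection `π : T¹ℍ → T¹M`. -/
def proj (v : T1H) : T1M := Quotient.mk (MulAction.orbitRel SL(2, ℤ) T1H) v

/-! ### The geodesic flow -/

/-- The point `tanh (t / 2) ω`, `ω = -i ζ / Im z`, of the open unit disc. The Möbius map
`w ↦ (z - z̄ w) / (1 - w)` is an isometry of the Poincaré disc onto `ℍ` sending `0` to `z` and
the radius in direction `ω` to the geodesic ray leaving `z` in direction `ζ`. -/
def discPoint (t : ℝ) (v : T1H) : ℂ :=
  (Real.tanh (t / 2) : ℂ) * (-Complex.I * v.dir / v.base.im)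

theorem norm_unit (v : T1H) : ‖-Complex.I * v.dir / (v.base.im : ℂ)‖ = 1 := by
  have h := v.base.im_pos
  rw [norm_div, norm_mul, v.norm_dir]
  simp [abs_of_pos h, h.ne']

theorem norm_discPoint (t : ℝ) (v : T1H) : ‖discPoint t v‖ = |Real.tanh (t / 2)| := by
  rw [discPoint, norm_mul, norm_unit, Complex.norm_real, mul_one, Real.norm_eq_abs]

theorem norm_discPoint_lt (t : ℝ) (v : T1H) : ‖discPoint t v‖ < 1 := by
  rw [norm_discPoint]; exact Real.abs_tanh_lt_one _

theorem one_sub_discPoint_ne (t : ℝ) (v : T1H) : 1 - discPoint t v ≠ 0 := by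
  intro h
  have h1 : discPoint t v = 1 := (sub_eq_zero.mp h).symm
  have h2 := norm_discPoint_lt t v
  rw [h1] at h2; simp at h2

theorem im_moebius (z : ℍ) (w : ℂ) :
    (((z : ℂ) - conj (z : ℂ) * w) / (1 - w)).im = z.im * (1 - ‖w‖ ^ 2) / ‖1 - w‖ ^ 2 := by
  rw [Complex.div_im, ← Complex.normSq_eq_norm_sq, ← Complex.normSq_eq_norm_sq]
  rw [div_sub_div_same]
  congr 1
  simp [Complex.normSq_apply]
  ring

/-- The geodesic flow `g_t` on `T¹ℍ`: `g_t (z, ζ)` is the position and the velocity at time `t`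
of the unit speed geodesic of `ℍ` which starts at `z` with velocity `ζ`. -/
def flowH (t : ℝ) (v : T1H) : T1H where
  base := ⟨((v.base : ℂ) - conj (v.base : ℂ) * discPoint t v) / (1 - discPoint t v), by
    rw [im_moebius]
    have h1 := norm_discPoint_lt t v
    have h2 : 0 < ‖1 - discPoint t v‖ := norm_pos_iff.mpr (one_sub_discPoint_ne t v)
    have h3 : 0 < 1 - ‖discPoint t v‖ ^ 2 := by nlinarith [norm_nonneg (discPoint t v)]
    have h4 := v.base.im_pos
    positivity⟩
  dir := (1 - (Real.tanh (t / 2) : ℂ) ^ 2) * v.dir / (1 - discPoint t v) ^ 2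
  norm_dir := by
    change _ = (((v.base : ℂ) - conj (v.base : ℂ) * discPoint t v) / (1 - discPoint t v)).im
    have h1 := Real.abs_tanh_lt_one (t / 2)
    have h3 : 0 < 1 - Real.tanh (t / 2) ^ 2 := by
      rw [← sq_abs]; nlinarith [abs_nonneg (Real.tanh (t / 2))]
    have h5 : ‖(1 - (Real.tanh (t / 2) : ℂ) ^ 2)‖ = 1 - Real.tanh (t / 2) ^ 2 := by
      rw [← Complex.ofReal_pow, ← Complex.ofReal_one, ← Complex.ofReal_sub, Complex.norm_real,
        Real.norm_of_nonneg h3.le]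
    rw [im_moebius, norm_discPoint, sq_abs, norm_div, norm_mul, norm_pow, v.norm_dir, h5]
    ring

theorem flowH_base (t : ℝ) (v : T1H) : ((flowH t v).base : ℂ) =
    ((v.base : ℂ) - conj (v.base : ℂ) * discPoint t v) / (1 - discPoint t v) := rfl

theorem flowH_dir (t : ℝ) (v : T1H) : (flowH t v).dir =
    (1 - (Real.tanh (t / 2) : ℂ) ^ 2) * v.dir / (1 - discPoint t v) ^ 2 := rfl

/-- The flow starts at the given unit tangent vector. -/
theorem flowH_zero (v : T1H) : flowH 0 v = v := by
  apply T1H.ext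
  · apply UpperHalfPlane.ext
    rw [flowH_base]; simp [discPoint]
  · rw [flowH_dir]; simp [discPoint]

/-- The base point of `g_t v` moves at unit speed along a geodesic line of `ℍ`. -/
theorem dist_flowH (s t : ℝ) (v : T1H) : dist (flowH s v).base (flowH t v).base = |s - t| := by
  have hs := one_sub_discPoint_ne s v
  have ht := one_sub_discPoint_ne t v
  have htc : 1 - conj (discPoint t v) ≠ 0 := by
    intro h0
    apply ht
    have := congrArg conj h0
    rwa [map_sub, map_one, Complex.conj_conj, map_zero] at this
  have hω := norm_unit v
  have hwt : discPoint s v - discPoint t v =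
      ((Real.tanh (s / 2) - Real.tanh (t / 2) : ℝ) : ℂ) *
        (-Complex.I * v.dir / (v.base.im : ℂ)) := by
    rw [discPoint, discPoint]; push_cast; ring
  have hww : discPoint s v * conj (discPoint t v) =
      ((Real.tanh (s / 2) * Real.tanh (t / 2) : ℝ) : ℂ) := by
    rw [discPoint, discPoint, map_mul, Complex.conj_ofReal, mul_mul_mul_comm, Complex.mul_conj,
      Complex.normSq_eq_norm_sq, hω]
    push_cast; ring
  have hz : ‖(v.base : ℂ) - conj (v.base : ℂ)‖ ≠ 0 := by
    rw [norm_ne_zero_iff, Complex.sub_conj]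
    simp [v.base.im_ne_zero]
  have h1 : ((flowH s v).base : ℂ) - (flowH t v).base =
      ((v.base : ℂ) - conj (v.base : ℂ)) * (discPoint s v - discPoint t v) /
        ((1 - discPoint s v) * (1 - discPoint t v)) := by
    rw [flowH_base, flowH_base]; field_simp; ring
  have h2 : ((flowH s v).base : ℂ) - conj ((flowH t v).base : ℂ) =
      ((v.base : ℂ) - conj (v.base : ℂ)) * (1 - discPoint s v * conj (discPoint t v)) /
        ((1 - discPoint s v) * (1 - conj (discPoint t v))) := by
    rw [flowH_base, flowH_base]
    simp only [map_div₀, map_sub, map_mul, map_one, Complex.conj_conj]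
    field_simp; ring
  have hconj : ‖1 - conj (discPoint t v)‖ = ‖1 - discPoint t v‖ := by
    rw [← Complex.norm_conj, map_sub, map_one, Complex.conj_conj]
  have hlt : 0 < 1 - Real.tanh (s / 2) * Real.tanh (t / 2) := by
    have a1 := Real.abs_tanh_lt_one (s / 2)
    have a2 := Real.abs_tanh_lt_one (t / 2)
    have a3 : |Real.tanh (s / 2) * Real.tanh (t / 2)| < 1 := by
      rw [abs_mul]
      nlinarith [abs_nonneg (Real.tanh (s / 2)), abs_nonneg (Real.tanh (t / 2))]
    linarith [(abs_lt.mp a3).2]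
  have h3 : Real.tanh (dist (flowH s v).base (flowH t v).base / 2) =
      |Real.tanh (s / 2) - Real.tanh (t / 2)| / (1 - Real.tanh (s / 2) * Real.tanh (t / 2)) := by
    rw [UpperHalfPlane.tanh_half_dist, Complex.dist_eq, Complex.dist_eq, h1, h2, hww, hwt]
    rw [norm_div, norm_div, norm_mul, norm_mul, norm_mul, norm_mul, norm_mul, hconj, hω,
      Complex.norm_real, ← Complex.ofReal_one, ← Complex.ofReal_sub, Complex.norm_real,
      Real.norm_eq_abs, Real.norm_eq_abs, abs_of_pos hlt, Complex.ofReal_one]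
    have n1 := norm_ne_zero_iff.mpr hs
    have n2 := norm_ne_zero_iff.mpr ht
    field_simp
  have hadd : Real.tanh ((s - t) / 2) =
      (Real.tanh (s / 2) - Real.tanh (t / 2)) / (1 - Real.tanh (s / 2) * Real.tanh (t / 2)) := by
    have c1 := (Real.cosh_pos (s / 2)).ne'
    have c2 := (Real.cosh_pos (t / 2)).ne'
    rw [eq_div_iff hlt.ne']
    rw [sub_div, Real.tanh_eq_sinh_div_cosh, Real.tanh_eq_sinh_div_cosh,
      Real.tanh_eq_sinh_div_cosh, Real.sinh_sub, Real.cosh_sub]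
    have c3 : Real.cosh (s / 2) * Real.cosh (t / 2) - Real.sinh (s / 2) * Real.sinh (t / 2) ≠ 0 := by
      rw [← Real.cosh_sub]; exact (Real.cosh_pos _).ne'
    rw [show Real.sinh (s / 2) / Real.cosh (s / 2) - Real.sinh (t / 2) / Real.cosh (t / 2) =
      (Real.sinh (s / 2) * Real.cosh (t / 2) - Real.cosh (s / 2) * Real.sinh (t / 2)) /
        (Real.cosh (s / 2) * Real.cosh (t / 2)) by field_simp,
      show 1 - Real.sinh (s / 2) / Real.cosh (s / 2) * (Real.sinh (t / 2) / Real.cosh (t / 2)) =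
      (Real.cosh (s / 2) * Real.cosh (t / 2) - Real.sinh (s / 2) * Real.sinh (t / 2)) /
        (Real.cosh (s / 2) * Real.cosh (t / 2)) by field_simp]
    rw [div_mul_div_comm, mul_comm (Real.cosh (s / 2) * Real.cosh (t / 2) - _),
      mul_div_mul_right _ _ c3]
  have h4 : Real.tanh (|s - t| / 2) =
      |Real.tanh (s / 2) - Real.tanh (t / 2)| / (1 - Real.tanh (s / 2) * Real.tanh (t / 2)) := by
    rw [← abs_of_pos hlt, ← abs_div, ← hadd]
    rcases le_total 0 (s - t) with h | h
    · rw [abs_of_nonneg h, abs_of_nonneg]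
      rw [Real.tanh_eq_sinh_div_cosh]
      exact div_nonneg (Real.sinh_nonneg_iff.mpr (by linarith)) (Real.cosh_pos _).le
    · rw [abs_of_nonpos h, abs_of_nonpos, neg_div, Real.tanh_neg]
      rw [Real.tanh_eq_sinh_div_cosh]
      exact div_nonpos_of_nonpos_of_nonneg (Real.sinh_nonpos_iff.mpr (by linarith))
        (Real.cosh_pos _).le
  have h5 := Real.tanh_injective (h3.trans h4.symm)
  linarith

/-- The vector of `g_t v` is the velocity of its base point. -/
theorem hasDerivAt_flowH (t : ℝ) (v : T1H) :
    HasDerivAt (fun s : ℝ => ((flowH s v).base : ℂ)) (flowH t v).dir t := by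
  have hi : (v.base.im : ℂ) ≠ 0 := Complex.ofReal_ne_zero.mpr v.base.im_ne_zero
  have hne := one_sub_discPoint_ne t v
  have hT : HasDerivAt (fun s : ℝ => Real.tanh (s / 2))
      ((1 - Real.tanh (t / 2) ^ 2) / 2) t := by
    have c := (Real.cosh_pos (t / 2)).ne'
    have hh : HasDerivAt (fun s : ℝ => s / 2) (1 / 2) t := (hasDerivAt_id t).div_const 2
    have := (hh.sinh).div (hh.cosh) c
    have e : (fun s : ℝ => Real.tanh (s / 2)) =
        (fun s : ℝ => Real.sinh (s / 2)) / fun s : ℝ => Real.cosh (s / 2) := by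
      funext s; simp [Real.tanh_eq_sinh_div_cosh]
    rw [e]
    refine this.congr_deriv ?_
    rw [Real.tanh_eq_sinh_div_cosh]
    field_simp
  have hw : HasDerivAt (fun s : ℝ => discPoint s v)
      (((1 - Real.tanh (t / 2) ^ 2) / 2 : ℝ) * (-Complex.I * v.dir / v.base.im)) t :=
    hT.ofReal_comp.mul_const _
  have hd := ((hw.const_mul (conj (v.base : ℂ))).const_sub (v.base : ℂ)).div
    (hw.const_sub 1) hne
  refine hd.congr_deriv ?_
  have hz : (v.base : ℂ) - conj (v.base : ℂ) = 2 * (v.base.im : ℂ) * Complex.I := by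
    rw [Complex.sub_conj]; simp
  have hz' : (v.base : ℂ) = conj (v.base : ℂ) + 2 * (v.base.im : ℂ) * Complex.I := by
    rw [← hz]; ring
  rw [flowH_dir]
  congr 1
  generalize discPoint t v = w
  generalize conj (v.base : ℂ) = z' at hz hz' ⊢
  rw [hz']
  push_cast
  field_simp
  ring_nf
  simp only [Complex.I_sq]
  ring

theorem discPoint_smul (t : ℝ) (g : SL(2, ℤ)) (v : T1H) :
    discPoint t (g • v) = discPoint t v * factor g (conj (v.base : ℂ)) / factor g v.base := by
  have h := factor_ne_zero g v.base
  have hc : conj (factor g v.base) = factor g (conj (v.base : ℂ)) := by simp [factor]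
  have hn : ((‖factor g v.base‖ ^ 2 : ℝ) : ℂ) =
      factor g v.base * factor g (conj (v.base : ℂ)) := by
    rw [← hc, Complex.mul_conj, Complex.normSq_eq_norm_sq]
  have hi : (v.base.im : ℂ) ≠ 0 := Complex.ofReal_ne_zero.mpr v.base.im_pos.ne'
  have hc0 : factor g (conj (v.base : ℂ)) ≠ 0 := by
    rw [← hc]; simpa using h
  rw [discPoint, discPoint, smul_base, smul_dir, im_smul_eq, Complex.ofReal_div, hn]
  field_simp

/-- The geodesic flow commutes with the action of the modular group. -/
theorem flowH_smul (t : ℝ) (g : SL(2, ℤ)) (v : T1H) : flowH t (g • v) = g • flowH t v := by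
  have h := factor_ne_zero g v.base
  have hne := one_sub_discPoint_ne t v
  have hc : conj (factor g v.base) = factor g (conj (v.base : ℂ)) := by simp [factor]
  have hc0 : factor g (conj (v.base : ℂ)) ≠ 0 := by rw [← hc]; simpa using h
  have hne' := one_sub_discPoint_ne t (g • v)
  have hF : factor g (flowH t v).base =
      (factor g v.base - factor g (conj (v.base : ℂ)) * discPoint t v) /
        (1 - discPoint t v) := by
    rw [flowH_base, factor, factor, factor]; field_simp; ring
  have hW : 1 - discPoint t (g • v) =
      (factor g v.base - factor g (conj (v.base : ℂ)) * discPoint t v) / factor g v.base := by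
    rw [discPoint_smul]; field_simp
  have hE : factor g v.base - factor g (conj (v.base : ℂ)) * discPoint t v ≠ 0 := by
    intro h0; rw [h0, zero_div] at hW; exact hne' hW
  apply T1H.ext
  · apply UpperHalfPlane.ext
    rw [flowH_base, smul_base, smul_base, coe_smul_eq g (flowH t v).base, hF, hW, coe_smul_eq,
      discPoint_smul, flowH_base]
    have hcc : conj ((((g 0 0 : ℤ) : ℂ) * v.base + ((g 0 1 : ℤ) : ℂ)) / factor g v.base) =
        (((g 0 0 : ℤ) : ℂ) * conj (v.base : ℂ) + ((g 0 1 : ℤ) : ℂ)) /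
          factor g (conj (v.base : ℂ)) := by
      rw [map_div₀, hc]; simp
    rw [hcc]
    field_simp
    ring
  · rw [flowH_dir, smul_dir, smul_dir, hF, hW, flowH_dir]
    field_simp

/-- The geodesic flow `g_t` on `T¹M`, i.e. `g_t (π v) = π (g_t v)`. -/
def flow (t : ℝ) : T1M → T1M :=
  Quotient.map (sa := MulAction.orbitRel SL(2, ℤ) T1H) (sb := MulAction.orbitRel SL(2, ℤ) T1H)
    (flowH t) (by
      rintro v w ⟨g, rfl⟩
      exact ⟨g, (flowH_smul t g w).symm⟩)

theorem flow_proj (t : ℝ) (v : T1H) : flow t (proj v) = proj (flowH t v) := rfl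

/-- `x` is the attracting (forward) endpoint of the oriented geodesic of `ℍ` with initial unit
tangent vector `v`. -/
def IsAttractingEndpoint (v : T1H) (x : ℝ) : Prop :=
  Tendsto (fun t : ℝ => ((flowH t v).base : ℂ)) atTop (𝓝 (x : ℂ))

/-! ### Frequency of visits to the cusp -/

/-- The neighbourhood `π ({Im z > d} × S¹)` of the cusp in `T¹M`. -/
def cuspNhd (d : ℝ) : Set T1M := proj '' {v : T1H | d < v.base.im}

/-- The proportion `(1/T) ∫₀ᵀ χ_d (g_t v) dt` of the time in `[0, T]` spent in `cuspNhd d`. -/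
def cuspProportion (d : ℝ) (v : T1M) (T : ℝ) : ℝ :=
  (1 / T) * ∫ t in (0 : ℝ)..T, (cuspNhd d).indicator (fun _ => (1 : ℝ)) (flow t v)

/-- The forward orbit `{g_t v}_{t ≥ 0}` visits the cusp with frequency `0`. -/
def VisitsCuspWithFreqZero (v : T1M) : Prop :=
  ∃ d : ℝ, 1 < d ∧ Tendsto (cuspProportion d v) atTop (𝓝 0)

/-- The forward orbit `{g_t v}_{t ≥ 0}` visits the cusp with frequency `1`. -/
def VisitsCuspWithFreqOne (v : T1M) : Prop :=
  ∀ d : ℝ, 1 < d → Tendsto (cuspProportion d v) atTop (𝓝 1)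

/-! ### `(a,b)`-continued fractions -/

/-- The generalized integral part `[x]_{a,b}`. In the last case it is `⌈x - b⌉` with the
convention `⌈y⌉ = ⌊y⌋ + 1`. -/
def intPart (a b x : ℝ) : ℤ :=
  if x < a then ⌊x - a⌋ else if x < b then 0 else ⌊x - b⌋ + 1

/-- The complete quotients `x_0 = x`, `x_{j+1} = -1 / (x_j - [x_j]_{a,b})`. -/
def completeQuotient (a b x : ℝ) : ℕ → ℝ
  | 0 => x
  | j + 1 => -1 / (completeQuotient a b x j - intPart a b (completeQuotient a b x j))

/-- The partial quotients `a_j = [x_j]_{a,b}` of `x = [a_0, a_1, a_2, …]_{a,b}`. -/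
def partialQuotient (a b x : ℝ) (j : ℕ) : ℤ := intPart a b (completeQuotient a b x j)

/-- The modified partial quotients `a_j^ξ`. -/
def modifiedQuotient (a b x ξ : ℝ) (j : ℕ) : ℤ :=
  if ξ < |(partialQuotient a b x j : ℝ)| then partialQuotient a b x j else 1

/-- `A_N = (1/N) ∑_{j<N} log |a_j|` (a possible initial term with `a_0 = 0` counts as `0`). -/
def logAverage (a b x : ℝ) (N : ℕ) : ℝ :=
  (1 / (N : ℝ)) * ∑ j ∈ Finset.range N, Real.log |(partialQuotient a b x j : ℝ)|

/-- `A_N^ξ = (1/N) ∑_{j<N} log |a_j^ξ|`. -/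
def modifiedLogAverage (a b x ξ : ℝ) (N : ℕ) : ℝ :=
  (1 / (N : ℝ)) * ∑ j ∈ Finset.range N, Real.log |(modifiedQuotient a b x ξ j : ℝ)|

/-! ### The set `𝒮` of parameters -/

/-- The parameter set `𝒫`. -/
def paramP : Set (ℝ × ℝ) := {p | -1 ≤ p.1 ∧ p.1 < 0 ∧ 0 < p.2 ∧ p.2 ≤ 1 ∧ 1 ≤ p.2 - p.1}

/-- The slow map `f_{a,b}` of `ℝ ∪ {∞}`: it is `x ↦ x + 1` for `x < a`, `x ↦ -1/x` for
`a ≤ x < b` (sending `0` to `∞`), `x ↦ x - 1` for `x ≥ b`, and it fixes `∞`. -/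
def slowMap (a b : ℝ) : OnePoint ℝ → OnePoint ℝ
  | none => OnePoint.infty
  | some x =>
    if x < a then ((x + 1 : ℝ) : OnePoint ℝ)
    else if x < b then (if x = 0 then OnePoint.infty else ((-1 / x : ℝ) : OnePoint ℝ))
    else ((x - 1 : ℝ) : OnePoint ℝ)

/-- The forward orbit of `y` under `f` is eventually periodic. -/
def EventuallyPeriodic {α : Type*} (f : α → α) (y : α) : Prop :=
  ∃ m p : ℕ, 0 < p ∧ f^[m + p] y = f^[m] y

/-- The orbits of `y` and `z` under `f` are both eventually periodic or they meet. -/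
def PeriodicOrMeet {α : Type*} (f : α → α) (y z : α) : Prop :=
  (EventuallyPeriodic f y ∧ EventuallyPeriodic f z) ∨ ∃ m k : ℕ, f^[m] y = f^[k] z

/-- The finiteness condition on `f_{a,b}`: for `a` the upper orbit (that of `-1/a`) and the lower
orbit (that of `a + 1`), and for `b` the upper orbit (that of `b - 1`) and the lower orbit (that
of `-1/b`), are either both eventually periodic or meet, forming a cycle. -/
def FinitenessCondition (a b : ℝ) : Prop :=
  PeriodicOrMeet (slowMap a b) ((-1 / a : ℝ) : OnePoint ℝ) ((a + 1 : ℝ) : OnePoint ℝ) ∧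
  PeriodicOrMeet (slowMap a b) ((b - 1 : ℝ) : OnePoint ℝ) ((-1 / b : ℝ) : OnePoint ℝ)

/-- `𝒮 = 𝒫 \ ℰ`, where `ℰ` is the set of parameters violating the finiteness condition. -/
def paramS : Set (ℝ × ℝ) := {p | p ∈ paramP ∧ FinitenessCondition p.1 p.2}

end CuspExcursion

end

open CuspExcursion

/-!
Let `x_n` and `p_n / q_n` be the complete quotients and the convergents of `x`, and let `t_1 = 0`,
`t_{n+1} - t_n = 2 log |x_n| = 2 log |a_n| + O(1)`. The geodesic ray stays at bounded distance from
the vertical ray `x + i e^{-t}`, and the matrix with rows `(q_{n-2}, -p_{n-2})`, `(q_{n-1},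
-p_{n-1})` takes the latter to height `exp (min (t - t_n) (t_{n+1} - t))` up to a bounded factor,
because `|q_{n-1} (q_{n-2} x - p_{n-2})|` is bounded above and away from `0`: the denominators
increase in absolute value, since a digit `±1` never follows a digit of its own sign, and a
complete quotient that follows a digit of its own sign exceeds `1` in absolute value by a fixed
margin. As horoballs at different cusps are disjoint, the time spent above a fixed height during
`(t_n, t_{n+1}]` is `2 log |a_n| + O(1)`, and it is `0` unless `|a_n|` is large. Any three of these
intervals have total length at least a fixed constant, so `t_N` dominates the number `N` of digits.
Hence frequency `0` means that the large `log |a_n|` sum to `o(N)`, and frequency `1` that `N =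
o(t_N)`.
-/

noncomputable section

open Filter Topology MeasureTheory Asymptotics
open scoped UpperHalfPlane MatrixGroups ComplexConjugate

namespace CuspExcursion

section Algorithm

variable {a b x y : ℝ}

theorem mem_paramP_iff :
    (a, b) ∈ paramP ↔ -1 ≤ a ∧ a < 0 ∧ 0 < b ∧ b ≤ 1 ∧ 1 ≤ b - a :=
  Iff.rfl

theorem sub_intPart_mem_Ico (hab : 1 ≤ b - a) (y : ℝ) : y - intPart a b y ∈ Set.Ico a b := by
  have := Int.floor_le (y - a)
  have := Int.lt_floor_add_one (y - a)
  have := Int.floor_le (y - b)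
  have := Int.lt_floor_add_one (y - b)
  unfold intPart
  split_ifs <;> push_cast <;> constructor <;> linarith

theorem intPart_neg_iff : intPart a b y < 0 ↔ y < a := by
  unfold intPart
  split_ifs with ha hb
  · simpa only [ha, iff_true] using Int.floor_lt.mpr (by push_cast; linarith)
  · simp only [lt_irrefl, ha]
  · have : 0 ≤ ⌊y - b⌋ := Int.floor_nonneg.mpr (by linarith)
    simp only [ha, iff_false]
    omega

theorem intPart_pos_iff (hab : a ≤ b) : 0 < intPart a b y ↔ b ≤ y := by
  unfold intPart
  split_ifs with ha hb
  · have : ⌊y - a⌋ < 0 := Int.floor_lt.mpr (by push_cast; linarith)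
    exact iff_of_false (by omega) (by linarith)
  · exact iff_of_false (lt_irrefl 0) (not_le.mpr hb)
  · have : 0 ≤ ⌊y - b⌋ := Int.floor_nonneg.mpr (by linarith)
    exact iff_of_true (by omega) (not_lt.mp hb)

theorem sub_intPart_lt_of_neg (h : intPart a b y < 0) :
    y - intPart a b y < a + 1 := by
  rw [intPart, if_pos (intPart_neg_iff.mp h)]
  linarith [Int.lt_floor_add_one (y - a)]

theorem le_sub_intPart_of_pos (hab : a ≤ b) (h : 0 < intPart a b y) :
    b - 1 ≤ y - intPart a b y := by
  have hy := (intPart_pos_iff hab).mp h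
  rw [intPart, if_neg (by linarith), if_neg (by linarith)]
  push_cast
  linarith [Int.floor_le (y - b)]

theorem abs_sub_intPart_le_one (hp : (a, b) ∈ paramP) (y : ℝ) : |y - intPart a b y| ≤ 1 := by
  obtain ⟨ha, -, -, hb, hab⟩ := mem_paramP_iff.mp hp
  have hr := sub_intPart_mem_Ico hab y
  exact abs_le.mpr ⟨by linarith [hr.1], by linarith [hr.2]⟩

theorem mul_intPart_pos (hp : (a, b) ∈ paramP) (hy : 1 < |y|) : 0 < y * intPart a b y := by
  obtain ⟨ha, ha', hb, hb', -⟩ := mem_paramP_iff.mp hp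
  rcases lt_abs.mp hy with h | h
  · have hk : 0 < intPart a b y := (intPart_pos_iff (by linarith)).mpr (by linarith)
    exact mul_pos (by linarith) (mod_cast hk)
  · have hk : intPart a b y < 0 := intPart_neg_iff.mpr (by linarith)
    exact mul_pos_of_neg_of_neg (by linarith) (mod_cast hk)

/-- The gap between `±1` and a complete quotient that follows a digit of its own sign. -/
def margin (a b : ℝ) : ℝ := min b (-a)

theorem margin_pos (hp : (a, b) ∈ paramP) : 0 < margin a b :=
  lt_min hp.2.2.1 (neg_pos.mpr hp.2.1)

theorem margin_le_right (a b : ℝ) : margin a b ≤ b := min_le_left _ _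

theorem margin_le_neg_left (a b : ℝ) : margin a b ≤ -a := min_le_right _ _

theorem one_add_le_next_of_pos (hp : (a, b) ∈ paramP) (hk : 0 < intPart a b y)
    (hr : y - intPart a b y < 0) : 1 + b ≤ -1 / (y - intPart a b y) := by
  obtain ⟨-, -, hb, -, hab⟩ := mem_paramP_iff.mp hp
  have hr' := le_sub_intPart_of_pos (by linarith) hk
  rw [le_div_iff_of_neg hr]
  nlinarith

theorem next_lt_sub_one_of_neg (hp : (a, b) ∈ paramP) (hk : intPart a b y < 0)
    (hr : 0 < y - intPart a b y) : -1 / (y - intPart a b y) < a - 1 := by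
  have ha := (mem_paramP_iff.mp hp).2.1
  have hr' := sub_intPart_lt_of_neg hk
  rw [div_lt_iff₀ hr]
  nlinarith

theorem one_add_le_or_lt_sub_one_of_mul_pos (hp : (a, b) ∈ paramP)
    (h : 0 < intPart a b y * (-1 / (y - intPart a b y))) :
    1 + b ≤ -1 / (y - intPart a b y) ∨ -1 / (y - intPart a b y) < a - 1 := by
  rcases pos_and_pos_or_neg_and_neg_of_mul_pos h with ⟨hk, hr⟩ | ⟨hk, hr⟩
  · refine .inl (one_add_le_next_of_pos hp (mod_cast hk) ?_)
    rwa [neg_div, neg_pos, one_div, inv_lt_zero] at hr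
  · refine .inr (next_lt_sub_one_of_neg hp (mod_cast hk) ?_)
    rwa [neg_div, neg_lt_zero, one_div, inv_pos] at hr

theorem one_add_margin_le_abs (h : 1 + b ≤ y ∨ y < a - 1) : 1 + margin a b ≤ |y| := by
  rcases h with h | h
  · linarith [margin_le_right a b, le_abs_self y]
  · linarith [margin_le_neg_left a b, neg_le_abs y]

theorem two_le_abs_intPart (hab : 1 ≤ b - a) (h : 1 + b ≤ y ∨ y < a - 1) :
    2 ≤ |intPart a b y| := by
  obtain ⟨hr₁, hr₂⟩ := sub_intPart_mem_Ico hab y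
  rcases h with h | h
  · have : 1 < intPart a b y := by exact_mod_cast (by linarith : (1 : ℝ) < intPart a b y)
    exact le_abs.mpr (.inl this)
  · have : intPart a b y < -1 := by exact_mod_cast (by linarith : (intPart a b y : ℝ) < -1)
    exact le_abs.mpr (.inr (by omega))

theorem completeQuotient_succ (a b x : ℝ) (n : ℕ) :
    completeQuotient a b x (n + 1) = -1 / (completeQuotient a b x n - partialQuotient a b x n) :=
  rfl

theorem irrational_completeQuotient (hx : Irrational x) :
    ∀ n, Irrational (completeQuotient a b x n)
  | 0 => hx
  | n + 1 => by
    rw [completeQuotient_succ, neg_div, one_div]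
    exact ((irrational_completeQuotient hx n).sub_intCast _).inv.neg

theorem completeQuotient_succ_mul (hx : Irrational x) (n : ℕ) :
    completeQuotient a b x (n + 1) * (completeQuotient a b x n - partialQuotient a b x n) = -1 :=
  div_mul_cancel₀ _ ((irrational_completeQuotient hx n).sub_intCast _).ne_zero

theorem one_lt_abs_completeQuotient_succ (hp : (a, b) ∈ paramP) (hx : Irrational x) (n : ℕ) :
    1 < |completeQuotient a b x (n + 1)| := by
  have hr : Irrational (completeQuotient a b x n - partialQuotient a b x n) :=
    (irrational_completeQuotient hx n).sub_intCast _
  have hne : |completeQuotient a b x n - partialQuotient a b x n| ≠ 1 := fun h ↦ by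
    rcases eq_or_eq_neg_of_abs_eq h with h | h
    · exact hr.ne_one h
    · exact hr.ne_int (-1) (by simpa using h)
  rw [completeQuotient_succ, abs_div, abs_neg, abs_one, one_lt_div (abs_pos.mpr hr.ne_zero)]
  exact lt_of_le_of_ne (abs_sub_intPart_le_one hp _) hne

theorem completeQuotient_mul_partialQuotient_pos (hp : (a, b) ∈ paramP) (hx : Irrational x)
    (n : ℕ) : 0 < completeQuotient a b x (n + 1) * partialQuotient a b x (n + 1) :=
  mul_intPart_pos hp (one_lt_abs_completeQuotient_succ hp hx n)

theorem partialQuotient_mul_completeQuotient_pos (hp : (a, b) ∈ paramP) (hx : Irrational x) {n : ℕ}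
    (h : 0 < partialQuotient a b x n * partialQuotient a b x (n + 1)) :
    0 < partialQuotient a b x n * completeQuotient a b x (n + 1) := by
  have hk : (0 : ℝ) < partialQuotient a b x n * partialQuotient a b x (n + 1) := mod_cast h
  refine pos_of_mul_pos_left ?_ (sq_nonneg (partialQuotient a b x (n + 1) : ℝ))
  calc (0 : ℝ) < _ := mul_pos hk (completeQuotient_mul_partialQuotient_pos hp hx n)
    _ = _ := by ring

theorem one_add_margin_le_abs_completeQuotient (hp : (a, b) ∈ paramP) {n : ℕ}
    (h : 0 < partialQuotient a b x n * completeQuotient a b x (n + 1)) :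
    1 + margin a b ≤ |completeQuotient a b x (n + 1)| :=
  one_add_margin_le_abs (one_add_le_or_lt_sub_one_of_mul_pos hp h)

theorem two_le_abs_partialQuotient (hp : (a, b) ∈ paramP) (hx : Irrational x) {n : ℕ}
    (h : 0 < partialQuotient a b x n * partialQuotient a b x (n + 1)) :
    2 ≤ |partialQuotient a b x (n + 1)| :=
  two_le_abs_intPart (mem_paramP_iff.mp hp).2.2.2.2
    (one_add_le_or_lt_sub_one_of_mul_pos hp (partialQuotient_mul_completeQuotient_pos hp hx h))

theorem partialQuotient_succ_ne_zero (hp : (a, b) ∈ paramP) (hx : Irrational x) (n : ℕ) :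
    partialQuotient a b x (n + 1) ≠ 0 := fun h ↦ by
  simpa [h] using completeQuotient_mul_partialQuotient_pos hp hx n

theorem one_le_abs_partialQuotient (hp : (a, b) ∈ paramP) (hx : Irrational x) (n : ℕ) :
    1 ≤ |(partialQuotient a b x (n + 1) : ℝ)| :=
  mod_cast Int.one_le_abs (partialQuotient_succ_ne_zero hp hx n)

theorem one_add_margin_le_abs_mul (hp : (a, b) ∈ paramP) (hx : Irrational x) (n : ℕ) :
    1 + margin a b ≤ |completeQuotient a b x (n + 1) * completeQuotient a b x (n + 2)| := by
  have hy := one_lt_abs_completeQuotient_succ hp hx n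
  have hy' := one_lt_abs_completeQuotient_succ hp hx (n + 1)
  rcases lt_or_ge 0 (partialQuotient a b x (n + 1) * completeQuotient a b x (n + 2)) with h | h
  · have hm := one_add_margin_le_abs_completeQuotient hp h
    rw [abs_mul]
    nlinarith
  · -- Writing `y = k + r` and `y' = -1 / r`, one has `y y' = k y' - 1 ≤ -2`.
    have hk := one_le_abs_partialQuotient hp hx n
    have hky : 1 ≤ -(partialQuotient a b x (n + 1) * completeQuotient a b x (n + 2)) := by
      rw [← abs_of_nonpos h, abs_mul]
      nlinarith
    have hmul := completeQuotient_succ_mul (a := a) (b := b) hx (n + 1)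
    have hb := (mem_paramP_iff.mp hp).2.2.2.1
    refine le_abs.mpr (.inr ?_)
    linarith [margin_le_right a b]

theorem abs_completeQuotient_le (hp : (a, b) ∈ paramP) (hx : Irrational x) (n : ℕ) :
    |completeQuotient a b x (n + 1)| ≤ 2 * |(partialQuotient a b x (n + 1) : ℝ)| := by
  have hk := one_le_abs_partialQuotient hp hx n
  have hr : |completeQuotient a b x (n + 1) - partialQuotient a b x (n + 1)| ≤ 1 :=
    abs_sub_intPart_le_one hp _
  linarith [abs_sub_abs_le_abs_sub (completeQuotient a b x (n + 1))
    (partialQuotient a b x (n + 1))]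

theorem abs_partialQuotient_le (hp : (a, b) ∈ paramP) (hx : Irrational x) (n : ℕ) :
    |(partialQuotient a b x (n + 1) : ℝ)| ≤ 2 * |completeQuotient a b x (n + 1)| := by
  have hy := one_lt_abs_completeQuotient_succ hp hx n
  have hr : |completeQuotient a b x (n + 1) - partialQuotient a b x (n + 1)| ≤ 1 :=
    abs_sub_intPart_le_one hp _
  rw [abs_sub_comm] at hr
  linarith [abs_sub_abs_le_abs_sub (partialQuotient a b x (n + 1) : ℝ)
    (completeQuotient a b x (n + 1))]

end Algorithm

section Convergents

variable {k : ℕ → ℤ} {x : ℝ} {y : ℕ → ℝ}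

/-- The numerator `p_{n-2}` of the `(n-2)`-nd convergent `k 0 - 1 / (k 1 - 1 / (k 2 - ⋯))`; the
index starts with the two conventional initial values. -/
def convNum (k : ℕ → ℤ) : ℕ → ℤ
  | 0 => 0
  | 1 => 1
  | n + 2 => k n * convNum k (n + 1) - convNum k n

/-- The denominator `q_{n-2}` of the `(n-2)`-nd convergent, indexed as `convNum`. -/
def convDen (k : ℕ → ℤ) : ℕ → ℤ
  | 0 => -1
  | 1 => 0
  | n + 2 => k n * convDen k (n + 1) - convDen k n

/-- The linear form `q_{n-2} x - p_{n-2}`. -/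
def convErr (k : ℕ → ℤ) (x : ℝ) (n : ℕ) : ℝ := convDen k n * x - convNum k n

theorem convNum_mul_convDen_sub (k : ℕ → ℤ) :
    ∀ n, convNum k n * convDen k (n + 1) - convNum k (n + 1) * convDen k n = 1
  | 0 => by simp [convNum, convDen]
  | n + 1 => by
    rw [← convNum_mul_convDen_sub k n, convNum, convDen]
    ring

theorem convDen_mul_convErr_sub (k : ℕ → ℤ) (x : ℝ) (n : ℕ) :
    convDen k (n + 1) * convErr k x n - convDen k n * convErr k x (n + 1) = -1 := by
  have hdet : (convNum k n * convDen k (n + 1) - convNum k (n + 1) * convDen k n : ℝ) = 1 :=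
    mod_cast convNum_mul_convDen_sub k n
  simp only [convErr]
  linear_combination -hdet

theorem convErr_add_two (k : ℕ → ℤ) (x : ℝ) (n : ℕ) :
    convErr k x (n + 2) = k n * convErr k x (n + 1) - convErr k x n := by
  simp only [convErr, convDen, convNum]
  push_cast
  ring

theorem convErr_eq_mul (h₀ : y 0 = x) (hy : ∀ n, y (n + 1) * (y n - k n) = -1) :
    ∀ n, convErr k x n = y n * convErr k x (n + 1)
  | 0 => by simp [convErr, convDen, convNum, h₀]
  | n + 1 => by
    linear_combination -y (n + 1) * convErr_add_two k x n + y (n + 1) * convErr_eq_mul h₀ hy n +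
      convErr k x (n + 1) * hy n

theorem convErr_succ_ne_zero (h₀ : y 0 = x) (hy : ∀ n, y (n + 1) * (y n - k n) = -1) :
    ∀ n, convErr k x (n + 1) ≠ 0
  | 0 => by simp [convErr, convDen, convNum]
  | n + 1 => fun h ↦ convErr_succ_ne_zero h₀ hy n <| by
    rw [convErr_eq_mul h₀ hy, h, mul_zero]

theorem log_abs_convErr_succ (h₀ : y 0 = x) (hy : ∀ n, y (n + 1) * (y n - k n) = -1) (n : ℕ) :
    Real.log |convErr k x (n + 1)| = -∑ j ∈ Finset.Ico 1 (n + 1), Real.log |y j| := by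
  induction n with
  | zero => simp [convErr, convDen, convNum]
  | succ n ih =>
    have hne := convErr_succ_ne_zero h₀ hy (n + 1)
    have hy₀ : y (n + 1) ≠ 0 := left_ne_zero_of_mul ((hy n).trans_ne (by norm_num))
    rw [convErr_eq_mul h₀ hy, abs_mul,
      Real.log_mul (abs_ne_zero.mpr hy₀) (abs_ne_zero.mpr hne)] at ih
    rw [Finset.sum_Ico_succ_top (by omega)]
    linarith

/-- A digit sequence of a minus continued fraction in which, from index `1` on, no digit vanishes
and a digit `±1` never follows a digit of its own sign. -/
structure IsAdmissible (k : ℕ → ℤ) : Prop where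
  ne_zero (n : ℕ) : k (n + 1) ≠ 0
  two_le_abs (n : ℕ) : 0 < k n * k (n + 1) → 2 ≤ |k (n + 1)|

theorem abs_mul_sq_le_mul_sub {p q k : ℤ} (hpq : |p| ≤ |q|) (hk : k ≠ 0)
    (h : 0 < p * q * k → 2 ≤ |k|) : |k| * q ^ 2 ≤ q * (k * q - p) * k := by
  have hk₁ : 1 ≤ |k| := Int.one_le_abs hk
  have hq : 0 ≤ q ^ 2 := sq_nonneg q
  have hexpand : q * (k * q - p) * k = |k| * (|k| * q ^ 2) - p * q * k := by
    linear_combination (-q ^ 2) * sq_abs k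
  rw [hexpand]
  rcases le_or_gt (p * q * k) 0 with hs | hs
  · nlinarith [mul_nonneg (abs_nonneg k) hq]
  · have hpqk : p * q * k ≤ |k| * q ^ 2 := by
      calc p * q * k ≤ |p * q * k| := le_abs_self _
        _ = |p| * |q| * |k| := by rw [abs_mul, abs_mul]
        _ ≤ |q| * |q| * |k| := by gcongr
        _ = |k| * q ^ 2 := by rw [abs_mul_abs_self]; ring
    nlinarith [h hs, mul_nonneg (abs_nonneg k) hq]

/-- The third clause propagates the second one: it says that `q_n / q_{n-1}` has the sign of the
`n`-th digit. -/
theorem IsAdmissible.convDen_spec (hk : IsAdmissible k) (n : ℕ) :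
    convDen k (n + 2) ≠ 0 ∧ |convDen k (n + 1)| ≤ |convDen k (n + 2)| ∧
      (0 < convDen k (n + 1) * convDen k (n + 2) * k (n + 1) → 0 < k n * k (n + 1)) := by
  induction n with
  | zero => simp [convDen]
  | succ n ih =>
    obtain ⟨hq₀, hpq, hsign⟩ := ih
    have hstep : |k (n + 1)| * convDen k (n + 2) ^ 2 ≤
        convDen k (n + 2) * convDen k (n + 3) * k (n + 1) :=
      abs_mul_sq_le_mul_sub hpq (hk.ne_zero n) fun h ↦ hk.two_le_abs n (hsign h)
    have hk₀ : 0 < |k (n + 1)| := abs_pos.mpr (hk.ne_zero n)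
    have hpos : 0 < convDen k (n + 2) * convDen k (n + 3) * k (n + 1) :=
      (mul_pos hk₀ (by positivity)).trans_le hstep
    refine ⟨right_ne_zero_of_mul (left_ne_zero_of_mul hpos.ne'), ?_, fun h ↦ ?_⟩
    · have habs := hstep.trans (le_abs_self _)
      rw [abs_mul, abs_mul, ← sq_abs, mul_comm _ |k (n + 1)|] at habs
      have := le_of_mul_le_mul_left habs hk₀
      exact le_of_mul_le_mul_left (by linarith [sq |convDen k (n + 2)|]) (abs_pos.mpr hq₀)
    · refine pos_of_mul_pos_left ?_ (sq_nonneg (convDen k (n + 2) * convDen k (n + 3)))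
      calc 0 < _ := mul_pos hpos h
        _ = _ := by ring

/-- The identity `q e - p e' = -1` is balanced: the second product is dominated by the first. -/
theorem half_le_abs_mul {p q y e e' : ℝ} (hpq : |p| ≤ |q|) (hy : 1 ≤ |y|) (he : e = y * e')
    (hdet : q * e - p * e' = -1) : 1 / 2 ≤ |q * e| := by
  have hpe : |p * e'| ≤ |q * e| := by
    rw [he, abs_mul, abs_mul, abs_mul]
    exact mul_le_mul hpq (le_mul_of_one_le_left (abs_nonneg _) hy) (abs_nonneg _) (abs_nonneg _)
  have h1 : 1 ≤ |q * e| + |p * e'| := by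
    simpa only [hdet, abs_neg, abs_one] using abs_sub (q * e) (p * e')
  linarith

theorem abs_mul_le_one_add_inv {p q y e e' m : ℝ} (hm : 0 < m) (hpq : |p| ≤ |q|)
    (hy : 0 < p * q * y → 1 + m ≤ |y|) (he : e = y * e') (hdet : q * e - p * e' = -1) :
    |q * e| ≤ 1 + m⁻¹ := by
  have hm' : 0 < m⁻¹ := inv_pos.mpr hm
  rcases le_or_gt (p * q * y) 0 with hs | hs
  · have hprod : (q * e) * (p * e') ≤ 0 := by
      calc (q * e) * (p * e') = p * q * y * e' ^ 2 := by rw [he]; ring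
        _ ≤ 0 := mul_nonpos_of_nonpos_of_nonneg hs (sq_nonneg _)
    have : (q * e) ^ 2 ≤ 1 := by nlinarith [sq_nonneg (p * e')]
    linarith [(sq_le_one_iff_abs_le_one _).mp this]
  · have hpe : (1 + m) * |p * e'| ≤ |q * e| := by
      rw [he, abs_mul, abs_mul, abs_mul]
      calc (1 + m) * (|p| * |e'|) ≤ |y| * (|q| * |e'|) := by gcongr; exact hy hs
        _ = |q| * (|y| * |e'|) := by ring
    have h1 : |q * e| ≤ 1 + |p * e'| := by
      have := abs_sub_abs_le_abs_sub (q * e) (p * e')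
      rw [hdet, abs_neg, abs_one] at this
      linarith
    have h2 : m * |p * e'| ≤ 1 := by linarith
    linarith [(le_inv_mul_iff₀ hm).mpr h2]

end Convergents

section VerticalRay

variable {v : T1H} {x : ℝ}

/-- The point `x + i e^{-t}` of the vertical geodesic ending at `x`. -/
def verticalRay (x t : ℝ) : ℍ := ⟨⟨x, Real.exp (-t)⟩, Real.exp_pos _⟩

theorem verticalRay_im (x t : ℝ) : (verticalRay x t).im = Real.exp (-t) := rfl

theorem cosh_dist_verticalRay (z : ℍ) (x t : ℝ) :
    Real.cosh (dist z (verticalRay x t)) =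
      (‖(z : ℂ) - x‖ ^ 2 * Real.exp t + Real.exp (-t)) / (2 * z.im) := by
  have hexp : Real.exp (-t) * Real.exp t = 1 := by
    rw [← Real.exp_add, neg_add_cancel, Real.exp_zero]
  have hnorm : dist (z : ℂ) (verticalRay x t) ^ 2 =
      ‖(z : ℂ) - x‖ ^ 2 - 2 * z.im * Real.exp (-t) + Real.exp (-t) ^ 2 := by
    rw [Complex.dist_eq, Complex.sq_norm, Complex.sq_norm, Complex.normSq_apply,
      Complex.normSq_apply]
    simp only [verticalRay, Complex.sub_re, Complex.sub_im, UpperHalfPlane.coe_re,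
      UpperHalfPlane.coe_im, Complex.ofReal_re, Complex.ofReal_im]
    ring
  have him := z.im_ne_zero
  have hexp₀ := (Real.exp_pos (-t)).ne'
  rw [UpperHalfPlane.cosh_dist, hnorm, verticalRay_im]
  field_simp
  linear_combination -‖(z : ℂ) - x‖ ^ 2 * hexp

theorem one_sub_tanh_half (t : ℝ) :
    1 - Real.tanh (t / 2) = Real.exp (-t) * (1 + Real.tanh (t / 2)) := by
  have h : Real.exp (-t) = Real.exp (-(t / 2)) ^ 2 := by rw [sq, ← Real.exp_add]; ring_nf
  have h' : Real.exp (-(t / 2)) * Real.exp (t / 2) = 1 := by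
    rw [← Real.exp_add, neg_add_cancel, Real.exp_zero]
  have := Real.exp_pos (t / 2)
  have := Real.exp_pos (-(t / 2))
  rw [Real.tanh_eq, h]
  field_simp
  linear_combination (-2 * Real.exp (-(t / 2))) * h'

theorem tendsto_tanh_half_atTop : Tendsto (fun t : ℝ ↦ Real.tanh (t / 2)) atTop (𝓝 1) := by
  have h : Tendsto (fun t : ℝ ↦ 1 - Real.exp (-t) * (1 + Real.tanh (t / 2))) atTop (𝓝 (1 - 0)) := by
    refine tendsto_const_nhds.sub (squeeze_zero_norm (fun t ↦ ?_)
      (by simpa using (Real.tendsto_exp_neg_atTop_nhds_zero.mul_const 2)))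
    obtain ⟨h₁, h₂⟩ := abs_lt.mp (Real.abs_tanh_lt_one (t / 2))
    rw [norm_mul, Real.norm_eq_abs, Real.abs_exp, Real.norm_eq_abs, abs_of_pos (by linarith)]
    gcongr
    linarith
  simpa only [← one_sub_tanh_half, sub_sub_cancel, sub_zero] using h

/-- The limit of `discPoint t v` as `t → ∞`, on the unit circle. -/
def boundaryPoint (v : T1H) : ℂ := -Complex.I * v.dir / v.base.im

theorem discPoint_eq_mul (t : ℝ) (v : T1H) : discPoint t v = Real.tanh (t / 2) * boundaryPoint v :=
  rfl

theorem tendsto_discPoint (v : T1H) :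
    Tendsto (fun t ↦ discPoint t v) atTop (𝓝 (boundaryPoint v)) := by
  have hτ : Tendsto (fun t : ℝ ↦ (Real.tanh (t / 2) : ℂ)) atTop (𝓝 ((1 : ℝ) : ℂ)) :=
    (Complex.continuous_ofReal.tendsto 1).comp tendsto_tanh_half_atTop
  simpa only [discPoint_eq_mul, Complex.ofReal_one, one_mul] using hτ.mul_const (boundaryPoint v)

theorem norm_sub_conj (z : ℍ) : ‖(z : ℂ) - conj (z : ℂ)‖ = 2 * z.im := by
  rw [Complex.sub_conj]
  simp [abs_of_pos z.im_pos]

theorem endpoint_mul_one_sub (hx : IsAttractingEndpoint v x) :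
    (x : ℂ) * (1 - boundaryPoint v) = v.base - conj (v.base : ℂ) * boundaryPoint v := by
  refine tendsto_nhds_unique (hx.mul ((tendsto_discPoint v).const_sub 1))
    ((((tendsto_discPoint v).const_mul (conj (v.base : ℂ))).const_sub (v.base : ℂ)).congr
      fun t ↦ ?_)
  rw [flowH_base, div_mul_cancel₀ _ (one_sub_discPoint_ne t v)]

theorem one_sub_boundaryPoint_ne_zero (hx : IsAttractingEndpoint v x) :
    1 - boundaryPoint v ≠ 0 := fun h ↦ by
  have hz := norm_sub_conj v.base
  have hlim := endpoint_mul_one_sub hx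
  rw [h, mul_zero, ← sub_eq_zero.mp h, mul_one] at hlim
  rw [← hlim, norm_zero] at hz
  linarith [v.base.im_pos]

theorem norm_flowH_sub_endpoint_sq (hx : IsAttractingEndpoint v x) (t : ℝ) :
    ‖((flowH t v).base : ℂ) - x‖ ^ 2 * Real.exp t =
      4 * v.base.im / ‖1 - boundaryPoint v‖ ^ 2 * (flowH t v).base.im := by
  set τ := Real.tanh (t / 2)
  set w := boundaryPoint v
  have hdisc : discPoint t v = τ * w := discPoint_eq_mul t v
  have hw : 1 - w ≠ 0 := one_sub_boundaryPoint_ne_zero hx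
  have hwt : 1 - τ * w ≠ 0 := one_sub_discPoint_ne t v
  have hsub : ((flowH t v).base : ℂ) - x =
      -(w * (v.base - conj (v.base : ℂ)) * ((1 - τ : ℝ) : ℂ)) / ((1 - τ * w) * (1 - w)) := by
    rw [flowH_base, hdisc, eq_div_of_mul_eq hw (endpoint_mul_one_sub hx)]
    push_cast
    field_simp
    ring
  have him : (flowH t v).base.im = v.base.im * (1 - τ ^ 2) / ‖1 - τ * w‖ ^ 2 := by
    have := im_moebius v.base (discPoint t v)
    rwa [norm_discPoint, sq_abs] at this
  have hnorm : ‖w‖ = 1 := norm_unit v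
  have hexp : (1 - τ) * Real.exp t = 1 + τ := by
    rw [one_sub_tanh_half, mul_right_comm, ← Real.exp_add, neg_add_cancel, Real.exp_zero, one_mul]
  rw [him, hsub, norm_div, norm_neg, norm_mul, norm_mul, norm_mul, hnorm, norm_sub_conj,
    Complex.norm_real, div_pow, mul_pow, Real.norm_eq_abs, sq_abs]
  have h1 := norm_ne_zero_iff.mpr hw
  have h2 := norm_ne_zero_iff.mpr hwt
  field_simp
  linear_combination 4 * (1 - τ) * hexp

theorem abs_log_im_sub_log_im_le (g : SL(2, ℤ)) (z w : ℍ) :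
    |Real.log (g • z).im - Real.log (g • w).im| ≤ dist z w := by
  have hdist : dist (g • z) (g • w) = dist z w := dist_smul (g : SL(2, ℝ)) z w
  exact hdist ▸ UpperHalfPlane.dist_log_im_le (g • z) (g • w)

theorem abs_log_im_flowH_sub_le (v : T1H) (t : ℝ) :
    |Real.log (flowH t v).base.im - Real.log v.base.im| ≤ |t| := by
  have h := UpperHalfPlane.dist_log_im_le (flowH t v).base (flowH 0 v).base
  rwa [dist_flowH, sub_zero, flowH_zero] at h

theorem exp_neg_le_im_flowH_div {t : ℝ} (v : T1H) (ht : 0 ≤ t) :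
    Real.exp (-t) ≤ (flowH t v).base.im / v.base.im := by
  have h := (abs_le.mp (abs_log_im_flowH_sub_le v t)).1
  rw [abs_of_nonneg ht, ← Real.log_div (flowH t v).base.im_ne_zero v.base.im_ne_zero] at h
  exact (Real.le_log_iff_exp_le (div_pos (flowH t v).base.im_pos v.base.im_pos)).mp h

theorem exists_dist_verticalRay_le (hx : IsAttractingEndpoint v x) :
    ∃ K, ∀ t, 0 ≤ t → dist (flowH t v).base (verticalRay x t) ≤ K := by
  refine ⟨(4 * v.base.im / ‖1 - boundaryPoint v‖ ^ 2 + v.base.im⁻¹) / 2, fun t ht ↦ ?_⟩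
  have := (flowH t v).base.im_pos
  calc dist (flowH t v).base (verticalRay x t)
      ≤ Real.sinh (dist (flowH t v).base (verticalRay x t)) :=
        Real.self_le_sinh_iff.mpr dist_nonneg
    _ ≤ Real.cosh (dist (flowH t v).base (verticalRay x t)) := (Real.sinh_lt_cosh _).le
    _ ≤ _ := by
      rw [cosh_dist_verticalRay, norm_flowH_sub_endpoint_sq hx, div_le_div_iff₀ (by positivity)
        two_pos]
      have := exp_neg_le_im_flowH_div v ht
      rw [div_eq_mul_inv] at this
      linarith

end VerticalRay

section Cusp

/-- Horoballs at different cusps are disjoint: an element which does not fix `∞` maps the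
height `y` to a height at most `1 / y`. -/
theorem im_smul_eq_im_of_one_lt (g : SL(2, ℤ)) (z : ℍ) (h : 1 < (g • z).im * z.im) :
    (g • z).im = z.im := by
  have hz := z.im_pos
  have hc : g 1 0 = 0 := by
    by_contra hc
    have hc₁ : (1 : ℝ) ≤ (g 1 0 : ℝ) ^ 2 := mod_cast (one_le_sq_iff_one_le_abs _).mpr
      (Int.one_le_abs hc)
    have him : z.im ^ 2 ≤ ‖factor g z‖ ^ 2 := by
      rw [Complex.sq_norm, Complex.normSq_apply]
      simp only [factor, Complex.add_re, Complex.add_im, Complex.mul_re, Complex.mul_im,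
        Complex.intCast_re, Complex.intCast_im, UpperHalfPlane.coe_re, UpperHalfPlane.coe_im]
      nlinarith [sq_nonneg ((g 1 0 : ℝ) * z.re + g 1 1), sq_nonneg z.im]
    rw [im_smul_eq, div_mul_eq_mul_div, one_lt_div (by nlinarith), ← sq] at h
    exact absurd him (not_le.mpr h)
  have hd : IsUnit (g 1 1) := by
    refine IsUnit.of_mul_eq_one (g 0 0) ?_
    have hdet := g.det_coe
    rwa [Matrix.det_fin_two, hc, mul_zero, sub_zero, mul_comm] at hdet
  have hfactor : ‖factor g z‖ = 1 := by
    rw [factor, hc, Int.cast_zero, zero_mul, zero_add, Complex.norm_intCast]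
    exact_mod_cast Int.isUnit_iff_abs_eq.mp hd
  rw [im_smul_eq, hfactor, one_pow, div_one]

end Cusp

section Heights

variable {a b x : ℝ}

/-- The modular transformation with rows `(q_{n-2}, -p_{n-2})` and `(q_{n-1}, -p_{n-1})`, which
sends the convergent `p_{n-1} / q_{n-1}` to the cusp `∞`. -/
def convMatrix (k : ℕ → ℤ) (n : ℕ) : SL(2, ℤ) :=
  ⟨!![convDen k n, -convNum k n; convDen k (n + 1), -convNum k (n + 1)], by
    rw [Matrix.det_fin_two_of, ← convNum_mul_convDen_sub k n]
    ring⟩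

theorem inv_im_smul_verticalRay (g : SL(2, ℤ)) (x t : ℝ) :
    (g • verticalRay x t).im⁻¹ =
      g 1 0 ^ 2 * Real.exp (-t) + (g 1 0 * x + g 1 1) ^ 2 * Real.exp t := by
  have hnorm : ‖factor g (verticalRay x t)‖ ^ 2 =
      (g 1 0 * x + g 1 1) ^ 2 + (g 1 0 * Real.exp (-t)) ^ 2 := by
    rw [Complex.sq_norm, Complex.normSq_apply]
    simp only [factor, verticalRay, Complex.add_re, Complex.mul_re, Complex.intCast_re,
      Complex.intCast_im, zero_mul, sub_zero, Complex.add_im, Complex.mul_im, add_zero]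
    ring
  have hexp : Real.exp (-t) * Real.exp t = 1 := by
    rw [← Real.exp_add, neg_add_cancel, Real.exp_zero]
  rw [im_smul_eq, inv_div, hnorm, verticalRay_im, div_eq_iff (Real.exp_pos _).ne']
  linear_combination (-(g 1 0 * x + g 1 1) ^ 2 : ℝ) * hexp

theorem inv_im_convMatrix_smul_verticalRay (k : ℕ → ℤ) (n : ℕ) (x t : ℝ) :
    (convMatrix k n • verticalRay x t).im⁻¹ =
      convDen k (n + 1) ^ 2 * Real.exp (-t) + convErr k x (n + 1) ^ 2 * Real.exp t := by
  rw [inv_im_smul_verticalRay]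
  simp [convMatrix, convErr, sub_eq_add_neg]

theorem abs_log_mul_exp_add_exp_sub_max_le {c L : ℝ} (hc₀ : 0 < c) (hc : L⁻¹ ≤ c) (hL : c + 1 ≤ L)
    (α β : ℝ) : |Real.log (c * Real.exp α + Real.exp β) - max α β| ≤ Real.log L := by
  have hL₀ : 0 < L := by linarith
  have hL₁ : L⁻¹ ≤ 1 := inv_le_one_of_one_le₀ (by linarith)
  have hα := Real.exp_pos α
  have hβ := Real.exp_pos β
  have hlower : L⁻¹ * Real.exp (max α β) ≤ c * Real.exp α + Real.exp β := by
    rcases max_cases α β with ⟨h, -⟩ | ⟨h, -⟩ <;> rw [h] <;> nlinarith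
  have hupper : c * Real.exp α + Real.exp β ≤ L * Real.exp (max α β) := by
    calc c * Real.exp α + Real.exp β ≤ c * Real.exp (max α β) + Real.exp (max α β) := by
          gcongr
          exacts [le_max_left α β, le_max_right α β]
      _ ≤ L * Real.exp (max α β) := by rw [← add_one_mul]; gcongr
  have hlog₁ := Real.log_le_log (by positivity) hlower
  have hlog₂ := Real.log_le_log (by positivity) hupper
  rw [Real.log_mul (by positivity) (Real.exp_pos _).ne', Real.log_exp] at hlog₁ hlog₂
  rw [Real.log_inv] at hlog₁
  exact abs_le.mpr ⟨by linarith, by linarith⟩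

theorem isAdmissible_partialQuotient (hp : (a, b) ∈ paramP) (hx : Irrational x) :
    IsAdmissible (partialQuotient a b x) where
  ne_zero := partialQuotient_succ_ne_zero hp hx
  two_le_abs _ := two_le_abs_partialQuotient hp hx

theorem abs_convDen_mul_convErr_mem_Icc (hp : (a, b) ∈ paramP) (hx : Irrational x) (n : ℕ) :
    |convDen (partialQuotient a b x) (n + 2) * convErr (partialQuotient a b x) x (n + 1)| ∈
      Set.Icc (1 / 2) (1 + (margin a b)⁻¹) := by
  obtain ⟨-, hpq, hsign⟩ := (isAdmissible_partialQuotient hp hx).convDen_spec n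
  have hpq' : |(convDen (partialQuotient a b x) (n + 1) : ℝ)| ≤
      |(convDen (partialQuotient a b x) (n + 2) : ℝ)| := mod_cast hpq
  have hdet := convDen_mul_convErr_sub (partialQuotient a b x) x (n + 1)
  have he := convErr_eq_mul (x := x) rfl (completeQuotient_succ_mul (a := a) (b := b) hx) (n + 1)
  refine ⟨half_le_abs_mul hpq' (one_lt_abs_completeQuotient_succ hp hx n).le he hdet,
    abs_mul_le_one_add_inv (margin_pos hp) hpq' (fun h ↦ ?_) he hdet⟩
  have hk := completeQuotient_mul_partialQuotient_pos hp hx n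
  have hpqk : (0 : ℝ) < convDen (partialQuotient a b x) (n + 1) *
      convDen (partialQuotient a b x) (n + 2) * partialQuotient a b x (n + 1) := by
    refine pos_of_mul_pos_left ?_ (sq_nonneg (completeQuotient a b x (n + 1)))
    calc (0 : ℝ) < _ := mul_pos h hk
      _ = _ := by ring
  exact one_add_margin_le_abs_completeQuotient hp
    (partialQuotient_mul_completeQuotient_pos hp hx (hsign (mod_cast hpqk)))

/-- The time at which the vertical ray towards `x` leaves, up to a bounded error, the horoball
at its `(n-2)`-nd convergent and enters the one at the next convergent. -/
def returnTime (a b x : ℝ) (n : ℕ) : ℝ :=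
  2 * ∑ j ∈ Finset.Ico 1 n, Real.log |completeQuotient a b x j|

theorem convErr_sq_eq_exp (hx : Irrational x) (n : ℕ) :
    convErr (partialQuotient a b x) x (n + 1) ^ 2 = Real.exp (-returnTime a b x (n + 1)) := by
  have hy := completeQuotient_succ_mul (a := a) (b := b) hx
  have hne := convErr_succ_ne_zero (x := x) rfl hy n
  have hlog : Real.log (convErr (partialQuotient a b x) x (n + 1) ^ 2) =
      -returnTime a b x (n + 1) := by
    rw [Real.log_pow, ← Real.log_abs, log_abs_convErr_succ (x := x) rfl hy, returnTime,
      Nat.cast_ofNat, mul_neg]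
  rw [← hlog, Real.exp_log (by positivity)]

theorem inv_im_convMatrix_smul_verticalRay_eq_exp (hx : Irrational x) (n : ℕ) (t : ℝ) :
    (convMatrix (partialQuotient a b x) (n + 1) • verticalRay x t).im⁻¹ =
      |convDen (partialQuotient a b x) (n + 2) * convErr (partialQuotient a b x) x (n + 1)| ^ 2 *
        Real.exp (-(t - returnTime a b x (n + 1))) +
      Real.exp (-(returnTime a b x (n + 2) - t)) := by
  have hexp : Real.exp (-t) = Real.exp (-returnTime a b x (n + 1)) *
      Real.exp (-(t - returnTime a b x (n + 1))) := by
    rw [← Real.exp_add]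
    ring_nf
  rw [inv_im_convMatrix_smul_verticalRay, convErr_sq_eq_exp hx (n + 1), ← Real.exp_add,
    neg_add_eq_sub, neg_sub (returnTime a b x (n + 2)) t, sq_abs, mul_pow, convErr_sq_eq_exp hx n,
    hexp, mul_assoc]

theorem abs_log_im_convMatrix_smul_verticalRay_sub_le (hp : (a, b) ∈ paramP) (hx : Irrational x)
    (n : ℕ) (t : ℝ) :
    |Real.log (convMatrix (partialQuotient a b x) (n + 1) • verticalRay x t).im -
      min (t - returnTime a b x (n + 1)) (returnTime a b x (n + 2) - t)| ≤
      Real.log ((1 + (margin a b)⁻¹) ^ 2 + 3) := by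
  obtain ⟨hlower, hupper⟩ := abs_convDen_mul_convErr_mem_Icc hp hx n
  have hm := inv_pos.mpr (margin_pos hp)
  set c := |convDen (partialQuotient a b x) (n + 2) * convErr (partialQuotient a b x) x (n + 1)| ^ 2
    with hc
  have hc_lower : 1 / 4 ≤ c := by nlinarith
  have hc_upper : c ≤ (1 + (margin a b)⁻¹) ^ 2 := by rw [hc]; gcongr
  have hinv : ((1 + (margin a b)⁻¹) ^ 2 + 3)⁻¹ ≤ 1 / 4 := by
    rw [one_div]
    gcongr
    nlinarith
  have hlog := abs_log_mul_exp_add_exp_sub_max_le (by linarith) (hinv.trans hc_lower)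
    (by linarith) (-(t - returnTime a b x (n + 1))) (-(returnTime a b x (n + 2) - t))
  rwa [← inv_im_convMatrix_smul_verticalRay_eq_exp hx, Real.log_inv, max_neg_neg,
    neg_sub_neg, abs_sub_comm] at hlog

theorem exists_abs_log_im_convMatrix_smul_flowH_sub_le (hp : (a, b) ∈ paramP) (hx : Irrational x)
    {v : T1H} (hv : IsAttractingEndpoint v x) :
    ∃ C, ∀ n t, 0 ≤ t →
      |Real.log (convMatrix (partialQuotient a b x) (n + 1) • (flowH t v).base).im -
        min (t - returnTime a b x (n + 1)) (returnTime a b x (n + 2) - t)| ≤ C := by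
  obtain ⟨K, hK⟩ := exists_dist_verticalRay_le hv
  refine ⟨K + Real.log ((1 + (margin a b)⁻¹) ^ 2 + 3), fun n t ht ↦ ?_⟩
  exact (abs_sub_le _ _ _).trans (add_le_add ((abs_log_im_sub_log_im_le _ _ _).trans (hK t ht))
    (abs_log_im_convMatrix_smul_verticalRay_sub_le hp hx n t))

end Heights

section Asymptotics

theorem natCast_isBigO_of_add_le {f : ℕ → ℝ} {c : ℝ} {k : ℕ} (hf : ∀ n, 0 ≤ f n) (hc : 0 < c)
    (h : ∀ n, f n + c ≤ f (n + k)) : (Nat.cast : ℕ → ℝ) =O[atTop] f := by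
  have hk : 0 < k := Nat.pos_of_ne_zero fun hk ↦ by simpa [hk, hc.not_ge] using h 0
  have hblock (j m : ℕ) : c * m ≤ f (j + k * m) := by
    induction m with
    | zero => simpa using hf j
    | succ m ih =>
      have := h (j + k * m)
      rw [mul_add_one, ← add_assoc]
      push_cast
      linarith
  refine IsBigO.of_bound (2 * k / c) (eventually_atTop.mpr ⟨k, fun n hn ↦ ?_⟩)
  have hfn : c * (n / k : ℕ) ≤ f n := by simpa only [Nat.mod_add_div] using hblock (n % k) (n / k)
  have hdiv : n ≤ 2 * k * (n / k) := by
    have h₁ : 1 ≤ n / k := (Nat.one_le_div_iff hk).mpr hn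
    have h₂ : n % k < k := Nat.mod_lt n hk
    nlinarith [Nat.mod_add_div n k]
  rw [Real.norm_natCast, Real.norm_of_nonneg (hf n), div_mul_eq_mul_div, le_div_iff₀ hc]
  calc (n : ℝ) * c ≤ (2 * k * (n / k) : ℕ) * c := by gcongr
    _ = 2 * k * (c * (n / k : ℕ)) := by push_cast; ring
    _ ≤ 2 * k * f n := by gcongr

theorem natCast_succ_isBigO : (fun n : ℕ ↦ ((n + 1 : ℕ) : ℝ)) =O[atTop] (Nat.cast : ℕ → ℝ) := by
  refine IsBigO.of_bound 2 (eventually_atTop.mpr ⟨1, fun n hn ↦ ?_⟩)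
  rw [Real.norm_natCast, Real.norm_natCast]
  exact_mod_cast (by omega : n + 1 ≤ 2 * n)

theorem isLittleO_iff_of_sub_isBigO {α : Type*} {l : Filter α} {f g c : α → ℝ}
    (h : (fun i ↦ f i - g i) =O[l] c) : c =o[l] f ↔ c =o[l] g := by
  have trans_of_sub {f g : α → ℝ} (h : (fun i ↦ f i - g i) =O[l] c) (hf : c =o[l] f) :
      c =o[l] g :=
    hf.trans_isBigO <| (h.trans_isLittleO hf).right_isBigO_sub.congr_right fun i ↦ by ring
  exact ⟨trans_of_sub h, trans_of_sub (h.neg_left.congr_left fun i ↦ neg_sub _ _)⟩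

theorem isLittleO_id_of_comp_succ {G : ℝ → ℝ} {t : ℕ → ℝ} (hG : Monotone G) (hG₀ : 0 ≤ G 0)
    (ht : Monotone t) (ht₀ : t 0 = 0) (htop : Tendsto t atTop atTop)
    (h : (fun n ↦ G (t (n + 1))) =o[atTop] t) : G =o[atTop] (id : ℝ → ℝ) := by
  refine isLittleO_iff.mpr fun c hc ↦ ?_
  obtain ⟨N, hN⟩ := eventually_atTop.mp (isLittleO_iff.mp h hc)
  filter_upwards [eventually_ge_atTop (t N)] with T hT
  obtain ⟨m, hm⟩ := (htop.eventually_gt_atTop T).exists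
  obtain ⟨n, hNn, hnT, hTn⟩ : ∃ n, N ≤ n ∧ t n ≤ T ∧ T < t (n + 1) := by
    classical
    have hex : ∃ m, T < t m := ⟨m, hm⟩
    have hNfind : N < Nat.find hex := ht.reflect_lt (hT.trans_lt (Nat.find_spec hex))
    refine ⟨Nat.find hex - 1, by omega, not_lt.mp (Nat.find_min hex (by omega)), ?_⟩
    rw [Nat.sub_add_cancel (by omega)]
    exact Nat.find_spec hex
  have hn₀ : 0 ≤ t n := ht₀ ▸ ht n.zero_le
  have hGT : 0 ≤ G T := hG₀.trans (hG (hn₀.trans hnT))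
  rw [Real.norm_of_nonneg hGT, id, Real.norm_of_nonneg (hn₀.trans hnT)]
  calc G T ≤ G (t (n + 1)) := hG hTn.le
    _ ≤ ‖G (t (n + 1))‖ := le_abs_self _
    _ ≤ c * ‖t n‖ := hN n hNn
    _ ≤ c * T := by rw [Real.norm_of_nonneg hn₀]; gcongr

theorem sum_range_isBigO_natCast {f : ℕ → ℝ} {c : ℝ} (hf : ∀ n, |f n| ≤ c) :
    (fun N ↦ ∑ n ∈ Finset.range N, f n) =O[atTop] (Nat.cast : ℕ → ℝ) := by
  refine IsBigO.of_bound c (.of_forall fun N ↦ ?_)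
  calc ‖∑ n ∈ Finset.range N, f n‖ ≤ ∑ _n ∈ Finset.range N, c :=
        norm_sum_le_of_le _ fun n _ ↦ hf n
    _ = c * ‖(N : ℝ)‖ := by simp [mul_comm]

end Asymptotics

section Occupation

variable {S : Set ℝ} {s r : ℝ}

/-- The time spent in `S` during `(0, T]`. -/
def occupationTime (S : Set ℝ) (T : ℝ) : ℝ := volume.real (S ∩ Set.Ioc 0 T)

theorem occupationTime_zero (S : Set ℝ) : occupationTime S 0 = 0 := by simp [occupationTime]

theorem occupationTime_nonneg (S : Set ℝ) (T : ℝ) : 0 ≤ occupationTime S T := measureReal_nonneg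

theorem volume_inter_Ioc_ne_top (S : Set ℝ) (s r : ℝ) : volume (S ∩ Set.Ioc s r) ≠ ⊤ :=
  measure_inter_ne_top_of_right_ne_top measure_Ioc_lt_top.ne

theorem occupationTime_sub (hS : MeasurableSet S) (hs : 0 ≤ s) (hsr : s ≤ r) :
    occupationTime S r - occupationTime S s = volume.real (S ∩ Set.Ioc s r) := by
  rw [occupationTime, ← Set.Ioc_union_Ioc_eq_Ioc hs hsr, Set.inter_union_distrib_left,
    measureReal_union ((Set.Ioc_disjoint_Ioc_of_le le_rfl).mono Set.inter_subset_right
      Set.inter_subset_right) (hS.inter measurableSet_Ioc) (volume_inter_Ioc_ne_top S 0 s)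
      (volume_inter_Ioc_ne_top S s r), occupationTime, add_sub_cancel_left]

theorem occupationTime_mono (S : Set ℝ) : Monotone (occupationTime S) := fun _ r hsr ↦
  measureReal_mono (Set.inter_subset_inter_right S (Set.Ioc_subset_Ioc_right hsr))
    (volume_inter_Ioc_ne_top S 0 r)

theorem sub_occupationTime_mono (S : Set ℝ) : Monotone fun T ↦ T - occupationTime S T := by
  intro s r hsr
  have hsub : S ∩ Set.Ioc 0 r ⊆ (S ∩ Set.Ioc 0 s) ∪ Set.Ioc s r := fun y hy ↦ by
    rcases le_or_gt y s with h | h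
    · exact .inl ⟨hy.1, hy.2.1, h⟩
    · exact .inr ⟨h, hy.2.2⟩
  have hle : occupationTime S r ≤ occupationTime S s + (r - s) := by
    calc volume.real (S ∩ Set.Ioc 0 r) ≤ volume.real ((S ∩ Set.Ioc 0 s) ∪ Set.Ioc s r) :=
          measureReal_mono hsub (measure_union_lt_top (volume_inter_Ioc_ne_top S 0 s).lt_top
            measure_Ioc_lt_top).ne
      _ ≤ volume.real (S ∩ Set.Ioc 0 s) + volume.real (Set.Ioc s r) := measureReal_union_le _ _
      _ = _ := by rw [Real.volume_real_Ioc_of_le hsr, occupationTime]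
  linarith

theorem occupationTime_le_self (S : Set ℝ) (hr : 0 ≤ r) : occupationTime S r ≤ r :=
  sub_nonneg.mp <| by simpa only [occupationTime_zero, sub_zero] using sub_occupationTime_mono S hr

end Occupation

section Excursions

/-- The sum of those of `l 0, …, l (N - 1)` that exceed `r`. -/
def largeSum (l : ℕ → ℝ) (r : ℝ) (N : ℕ) : ℝ := ∑ n ∈ Finset.range N, if r < l n then l n else 0

/-- The time pattern of a ray that makes successive excursions of height about `l n` during the time
intervals `(t n, t (n + 1)]`, up to a bounded error `C`: the ray is above the level `u` except near
the two ends of the interval, so `B u`, the set of times spent above the level `u`, is up to error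
`C` the interval shortened by `u` on both sides. Any three excursions take at least the time `κ`. -/
structure ExcursionPattern (B : ℝ → Set ℝ) (t l : ℕ → ℝ) (C κ : ℝ) : Prop where
  measurableSet (u : ℝ) : MeasurableSet (B u)
  const_nonneg : 0 ≤ C
  rate_pos : 0 < κ
  time_zero : t 0 = 0
  time_mono : Monotone t
  time_step (n : ℕ) : |t (n + 1) - t n - 2 * l n| ≤ C
  time_growth (n : ℕ) : t n + κ ≤ t (n + 3)
  mem_of_lt {u s : ℝ} (n : ℕ) : 0 < u → t n + u + C < s → s < t (n + 1) - u - C → s ∈ B u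
  bounds_of_mem {u s : ℝ} (n : ℕ) : C ≤ u → s ∈ Set.Ioc (t n) (t (n + 1)) → s ∈ B u →
    t n + u - C ≤ s ∧ s ≤ t (n + 1) - u + C

namespace ExcursionPattern

variable {B : ℝ → Set ℝ} {t l : ℕ → ℝ} {C κ u r : ℝ}

theorem time_nonneg (h : ExcursionPattern B t l C κ) (n : ℕ) : 0 ≤ t n :=
  h.time_zero ▸ h.time_mono n.zero_le

theorem natCast_isBigO_time (h : ExcursionPattern B t l C κ) : (Nat.cast : ℕ → ℝ) =O[atTop] t :=
  natCast_isBigO_of_add_le h.time_nonneg h.rate_pos h.time_growth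

theorem tendsto_time (h : ExcursionPattern B t l C κ) : Tendsto t atTop atTop := by
  refine (Asymptotics.IsBigO.trans_tendsto_norm_atTop h.natCast_isBigO_time
    (tendsto_natCast_atTop_atTop.congr fun n ↦ (Real.norm_natCast n).symm)).congr fun n ↦ ?_
  exact Real.norm_of_nonneg (h.time_nonneg n)

theorem sub_occupationTime_step (h : ExcursionPattern B t l C κ) (u : ℝ) (n : ℕ) :
    occupationTime (B u) (t (n + 1)) - occupationTime (B u) (t n) =
      volume.real (B u ∩ Set.Ioc (t n) (t (n + 1))) :=
  occupationTime_sub (h.measurableSet u) (h.time_nonneg n) (h.time_mono n.le_succ)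

theorem le_occupationTime_step (h : ExcursionPattern B t l C κ) (hu : 0 < u) (n : ℕ) :
    t (n + 1) - t n - 2 * u - 2 * C ≤
      occupationTime (B u) (t (n + 1)) - occupationTime (B u) (t n) := by
  have hC := h.const_nonneg
  have hsub : Set.Ioo (t n + u + C) (t (n + 1) - u - C) ⊆
      B u ∩ Set.Ioc (t n) (t (n + 1)) := fun s hs ↦
    ⟨h.mem_of_lt n hu hs.1 hs.2, by linarith [hs.1], by linarith [hs.2]⟩
  rw [h.sub_occupationTime_step]
  refine le_trans ?_ (measureReal_mono hsub (volume_inter_Ioc_ne_top _ _ _))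
  rw [Real.volume_real_Ioo]
  exact le_max_of_le_left (by linarith)

theorem occupationTime_step_le (h : ExcursionPattern B t l C κ) (hu : C ≤ u) (n : ℕ) :
    occupationTime (B u) (t (n + 1)) - occupationTime (B u) (t n) ≤
      max (t (n + 1) - t n - 2 * u + 2 * C) 0 := by
  have hsub : B u ∩ Set.Ioc (t n) (t (n + 1)) ⊆
      Set.Icc (t n + u - C) (t (n + 1) - u + C) := fun s hs ↦ h.bounds_of_mem n hu hs.2 hs.1
  rw [h.sub_occupationTime_step]
  refine (measureReal_mono hsub measure_Icc_lt_top.ne).trans_eq ?_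
  rw [Real.volume_real_Icc]
  ring_nf

theorem time_eq_sum (h : ExcursionPattern B t l C κ) (N : ℕ) :
    t N = ∑ n ∈ Finset.range N, (t (n + 1) - t n) := by
  rw [Finset.sum_range_sub, h.time_zero, sub_zero]

theorem occupationTime_eq_sum (h : ExcursionPattern B t l C κ) (u : ℝ) (N : ℕ) :
    occupationTime (B u) (t N) =
      ∑ n ∈ Finset.range N,
        (occupationTime (B u) (t (n + 1)) - occupationTime (B u) (t n)) := by
  rw [Finset.sum_range_sub fun n ↦ occupationTime (B u) (t n), h.time_zero, occupationTime_zero,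
    sub_zero]

theorem time_sub_sum_isBigO (h : ExcursionPattern B t l C κ) :
    (fun N ↦ t N - 2 * ∑ n ∈ Finset.range N, l n) =O[atTop] (Nat.cast : ℕ → ℝ) := by
  refine (sum_range_isBigO_natCast h.time_step).congr_left fun N ↦ ?_
  rw [h.time_eq_sum, Finset.sum_sub_distrib, Finset.mul_sum]

theorem time_sub_largeSum_isBigO (h : ExcursionPattern B t l C κ) (hr : 0 < r) :
    (fun N ↦ t N - 2 * largeSum l r N) =O[atTop] (Nat.cast : ℕ → ℝ) := by
  have hstep (n : ℕ) : |t (n + 1) - t n - 2 * if r < l n then l n else 0| ≤ 2 * r + C := by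
    have hmono := h.time_mono n.le_succ
    have hbound := h.time_step n
    split_ifs with hl
    · linarith
    · rw [abs_le] at hbound ⊢
      constructor <;> linarith [h.const_nonneg]
  refine (sum_range_isBigO_natCast hstep).congr_left fun N ↦ ?_
  rw [h.time_eq_sum, Finset.sum_sub_distrib, largeSum, Finset.mul_sum]

theorem natCast_isLittleO_time_iff (h : ExcursionPattern B t l C κ) :
    (Nat.cast : ℕ → ℝ) =o[atTop] t ↔
      (Nat.cast : ℕ → ℝ) =o[atTop] fun N ↦ ∑ n ∈ Finset.range N, l n :=
  (isLittleO_iff_of_sub_isBigO h.time_sub_sum_isBigO).trans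
    (isLittleO_const_mul_right_iff two_ne_zero)

theorem largeSum_isLittleO (h : ExcursionPattern B t l C κ) (hu : 0 < u)
    (hB : occupationTime (B u) =o[atTop] (id : ℝ → ℝ)) :
    largeSum l (3 * C + 2 * u) =o[atTop] (Nat.cast : ℕ → ℝ) := by
  have hC := h.const_nonneg
  have hle (N : ℕ) : largeSum l (3 * C + 2 * u) N ≤ occupationTime (B u) (t N) := by
    rw [h.occupationTime_eq_sum, largeSum]
    refine Finset.sum_le_sum fun n _ ↦ ?_
    have hstep := h.le_occupationTime_step hu n
    split_ifs with hl
    · linarith [(abs_le.mp (h.time_step n)).1]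
    · exact sub_nonneg.mpr (occupationTime_mono _ (h.time_mono n.le_succ))
  have hnonneg (N : ℕ) : 0 ≤ largeSum l (3 * C + 2 * u) N :=
    Finset.sum_nonneg fun n _ ↦ by split_ifs with hl <;> linarith
  have htime : largeSum l (3 * C + 2 * u) =o[atTop] t :=
    (IsBigO.of_norm_le fun N ↦ by
      rw [Real.norm_of_nonneg (hnonneg N)]; exact hle N).trans_isLittleO
      (hB.comp_tendsto h.tendsto_time)
  exact htime.trans_isBigO <| ((htime.const_mul_left 2).right_isBigO_sub).trans
    (h.time_sub_largeSum_isBigO (by linarith))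

theorem occupationTime_isLittleO (h : ExcursionPattern B t l C κ) (hr : 0 < r)
    (hl : largeSum l r =o[atTop] (Nat.cast : ℕ → ℝ)) :
    occupationTime (B (r + 2 * C)) =o[atTop] (id : ℝ → ℝ) := by
  have hC := h.const_nonneg
  have hle (N : ℕ) : occupationTime (B (r + 2 * C)) (t N) ≤ 2 * largeSum l r N := by
    rw [h.occupationTime_eq_sum, largeSum, Finset.mul_sum]
    refine Finset.sum_le_sum fun n _ ↦ (h.occupationTime_step_le (by linarith) n).trans ?_
    have hstep := (abs_le.mp (h.time_step n)).2
    split_ifs with hl <;> exact max_le (by linarith) (by linarith)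
  refine isLittleO_id_of_comp_succ (occupationTime_mono _) (occupationTime_zero _).ge h.time_mono
    h.time_zero h.tendsto_time (IsLittleO.trans_isBigO ?_ h.natCast_isBigO_time)
  refine IsBigO.trans_isLittleO (.of_norm_le fun N ↦ ?_)
    (((hl.comp_tendsto (tendsto_add_atTop_nat 1)).const_mul_left 2).trans_isBigO
      natCast_succ_isBigO)
  rw [Real.norm_of_nonneg (occupationTime_nonneg _ _)]
  exact hle (N + 1)

theorem natCast_isLittleO_time (h : ExcursionPattern B t l C κ)
    (hB : (fun T ↦ T - occupationTime (B (C + 1)) T) =o[atTop] (id : ℝ → ℝ)) :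
    (Nat.cast : ℕ → ℝ) =o[atTop] t := by
  have hfree (m : ℕ) : min (t (m + 1) - t m) 2 ≤ t (m + 1) - t m -
      (occupationTime (B (C + 1)) (t (m + 1)) - occupationTime (B (C + 1)) (t m)) := by
    have hstep := h.occupationTime_step_le (u := C + 1) (by linarith) m
    rcases le_total (t (m + 1) - t m - 2 * (C + 1) + 2 * C) 0 with hm | hm
    · rw [max_eq_right hm] at hstep
      exact min_le_of_left_le (by linarith)
    · rw [max_eq_left hm] at hstep
      exact min_le_of_right_le (by linarith)
  refine IsBigO.trans_isLittleO (natCast_isBigO_of_add_le (k := 3)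
    (fun n ↦ sub_nonneg.mpr (occupationTime_le_self _ (h.time_nonneg n)))
    (lt_min h.rate_pos two_pos) fun n ↦ ?_) (hB.comp_tendsto h.tendsto_time)
  have hmin : min κ 2 ≤ min (t (n + 1) - t n) 2 + min (t (n + 2) - t (n + 1)) 2 +
      min (t (n + 3) - t (n + 2)) 2 := by
    have hκ := h.time_growth n
    have h₀ := h.time_mono n.le_succ
    have h₁ := h.time_mono (n + 1).le_succ
    have h₂ := h.time_mono (n + 2).le_succ
    grind
  linarith [hfree n, hfree (n + 1), hfree (n + 2)]

theorem sub_occupationTime_isLittleO (h : ExcursionPattern B t l C κ) (hu : 0 < u)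
    (ht : (Nat.cast : ℕ → ℝ) =o[atTop] t) :
    (fun T ↦ T - occupationTime (B u) T) =o[atTop] (id : ℝ → ℝ) := by
  have hnonneg (n : ℕ) : 0 ≤ t n - occupationTime (B u) (t n) :=
    sub_nonneg.mpr (occupationTime_le_self _ (h.time_nonneg n))
  have hle (N : ℕ) : t N - occupationTime (B u) (t N) ≤ (2 * u + 2 * C) * N := by
    rw [h.occupationTime_eq_sum, h.time_eq_sum, ← Finset.sum_sub_distrib]
    refine (Finset.sum_le_card_nsmul _ _ (2 * u + 2 * C) fun n _ ↦ ?_).trans_eq ?_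
    · linarith [h.le_occupationTime_step hu n]
    · rw [Finset.card_range, nsmul_eq_mul, mul_comm]
  have hbound : (fun N ↦ t (N + 1) - occupationTime (B u) (t (N + 1))) =O[atTop]
      (Nat.cast : ℕ → ℝ) :=
    (IsBigO.of_norm_le fun N ↦ (Real.norm_of_nonneg (hnonneg (N + 1))).trans_le
      (hle (N + 1))).trans (natCast_succ_isBigO.const_mul_left _)
  exact isLittleO_id_of_comp_succ (sub_occupationTime_mono _)
    (by rw [occupationTime_zero, sub_zero]) h.time_mono h.time_zero h.tendsto_time
    (hbound.trans_isLittleO ht)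

theorem exists_occupationTime_isLittleO_iff (h : ExcursionPattern B t l C κ) :
    (∃ u, 0 < u ∧ occupationTime (B u) =o[atTop] (id : ℝ → ℝ)) ↔
      ∃ r, 0 < r ∧ largeSum l r =o[atTop] (Nat.cast : ℕ → ℝ) := by
  have hC := h.const_nonneg
  constructor
  · rintro ⟨u, hu, hB⟩
    exact ⟨3 * C + 2 * u, by linarith, h.largeSum_isLittleO hu hB⟩
  · rintro ⟨r, hr, hl⟩
    exact ⟨r + 2 * C, by linarith, h.occupationTime_isLittleO hr hl⟩

theorem forall_sub_occupationTime_isLittleO_iff (h : ExcursionPattern B t l C κ) :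
    (∀ u, 0 < u → (fun T ↦ T - occupationTime (B u) T) =o[atTop] (id : ℝ → ℝ)) ↔
      (Nat.cast : ℕ → ℝ) =o[atTop] fun N ↦ ∑ n ∈ Finset.range N, l n := by
  have hC := h.const_nonneg
  rw [← h.natCast_isLittleO_time_iff]
  exact ⟨fun hB ↦ h.natCast_isLittleO_time (hB (C + 1) (by linarith)),
    fun ht u hu ↦ h.sub_occupationTime_isLittleO hu ht⟩

end ExcursionPattern

end Excursions

section CuspTimes

variable {d u c p q t : ℝ}

/-- The times at which the orbit of `v` is in the cusp neighbourhood `cuspNhd d`. -/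
def cuspTimes (v : T1M) (d : ℝ) : Set ℝ := {t | flow t v ∈ cuspNhd d}

theorem mem_cuspTimes_proj {v : T1H} :
    t ∈ cuspTimes (proj v) d ↔ ∃ g : SL(2, ℤ), d < (g • (flowH t v).base).im := by
  constructor
  · rintro ⟨w, hw, hproj⟩
    obtain ⟨g, rfl⟩ : w ∈ MulAction.orbit SL(2, ℤ) (flowH t v) := Quotient.exact hproj
    exact ⟨g, hw⟩
  · rintro ⟨g, hg⟩
    exact ⟨g • flowH t v, hg, Quotient.sound ⟨g, rfl⟩⟩

theorem continuous_flowH_base (v : T1H) : Continuous fun t ↦ (flowH t v).base :=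
  UpperHalfPlane.isEmbedding_coe.continuous_iff.mpr <|
    continuous_iff_continuousAt.mpr fun t ↦ (hasDerivAt_flowH t v).continuousAt

theorem isOpen_cuspTimes (v : T1M) (d : ℝ) : IsOpen (cuspTimes v d) := by
  obtain ⟨w, rfl⟩ : ∃ w, proj w = v := Quotient.exists_rep v
  have hunion : cuspTimes (proj w) d = ⋃ g : SL(2, ℤ), {t | d < (g • (flowH t w).base).im} := by
    ext t
    rw [mem_cuspTimes_proj, Set.mem_iUnion]
    rfl
  rw [hunion]
  exact isOpen_iUnion fun g ↦ isOpen_lt continuous_const <|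
    UpperHalfPlane.continuous_im.comp ((continuous_flowH_base w).const_smul (g : SL(2, ℝ)))

theorem cuspProportion_eq (v : T1M) (d : ℝ) {T : ℝ} (hT : 0 ≤ T) :
    cuspProportion d v T = occupationTime (cuspTimes v d) T / T := by
  have hint : ∫ t in (0 : ℝ)..T, (cuspNhd d).indicator (fun _ ↦ (1 : ℝ)) (flow t v) =
      ∫ t in Set.Ioc 0 T, (cuspTimes v d).indicator 1 t :=
    intervalIntegral.integral_of_le hT
  rw [cuspProportion, hint, integral_indicator_one (isOpen_cuspTimes v d).measurableSet,
    measureReal_restrict_apply (isOpen_cuspTimes v d).measurableSet, one_div_mul_eq_div,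
    occupationTime]

theorem tendsto_cuspProportion_zero_iff (v : T1M) (d : ℝ) :
    Tendsto (cuspProportion d v) atTop (𝓝 0) ↔
      occupationTime (cuspTimes v d) =o[atTop] (id : ℝ → ℝ) := by
  rw [isLittleO_iff_tendsto' (g := id) ((eventually_ne_atTop 0).mono fun T hT h ↦ absurd h hT)]
  exact tendsto_congr' ((eventually_ge_atTop 0).mono fun T ↦ cuspProportion_eq v d)

theorem tendsto_cuspProportion_one_iff (v : T1M) (d : ℝ) :
    Tendsto (cuspProportion d v) atTop (𝓝 1) ↔
      (fun T ↦ T - occupationTime (cuspTimes v d) T) =o[atTop] (id : ℝ → ℝ) := by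
  rw [isLittleO_iff_tendsto' (g := id) ((eventually_ne_atTop 0).mono fun T hT h ↦ absurd h hT),
    ← tendsto_const_sub_iff (1 : ℝ), sub_self]
  refine tendsto_congr' ((eventually_gt_atTop 0).mono fun T hT ↦ ?_)
  simp only [cuspProportion_eq v d hT.le, id_eq, sub_div, div_self hT.ne']

theorem exists_one_lt_iff_exp {P : ℝ → Prop} :
    (∃ d, 1 < d ∧ P d) ↔ ∃ u, 0 < u ∧ P (Real.exp u) := by
  constructor
  · rintro ⟨d, hd, h⟩
    exact ⟨Real.log d, Real.log_pos hd, by rwa [Real.exp_log (one_pos.trans hd)]⟩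
  · rintro ⟨u, hu, h⟩
    exact ⟨Real.exp u, Real.one_lt_exp_iff.mpr hu, h⟩

theorem visitsCuspWithFreqZero_iff (v : T1M) :
    VisitsCuspWithFreqZero v ↔
      ∃ u, 0 < u ∧ occupationTime (cuspTimes v (Real.exp u)) =o[atTop] (id : ℝ → ℝ) := by
  simp only [VisitsCuspWithFreqZero, exists_one_lt_iff_exp, tendsto_cuspProportion_zero_iff]

theorem visitsCuspWithFreqOne_iff (v : T1M) :
    VisitsCuspWithFreqOne v ↔ ∀ u, 0 < u →
      (fun T ↦ T - occupationTime (cuspTimes v (Real.exp u)) T) =o[atTop] (id : ℝ → ℝ) := by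
  rw [← not_iff_not]
  simp only [VisitsCuspWithFreqOne, not_forall, exists_prop, exists_one_lt_iff_exp,
    tendsto_cuspProportion_one_iff]

theorem lt_log_im_of_lt_im {g h : SL(2, ℤ)} {z : ℍ} (hg : Real.exp u < (g • z).im)
    (hh : -c ≤ Real.log (h • z).im) (hc : c ≤ u) : u < Real.log (h • z).im := by
  have hg' : (g * h⁻¹) • h • z = g • z := by rw [mul_smul, inv_smul_smul]
  have hprod : 1 < (g • z).im * (h • z).im := by
    calc 1 ≤ Real.exp u * Real.exp (-c) := by
          rw [← Real.exp_add, Real.one_le_exp_iff]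
          linarith
      _ < (g • z).im * (h • z).im := mul_lt_mul hg
          ((Real.le_log_iff_exp_le (h • z).im_pos).mp hh) (Real.exp_pos _) (g • z).im_pos.le
  rw [← hg'] at hprod
  rw [← im_smul_eq_im_of_one_lt _ _ hprod, hg']
  exact (Real.lt_log_iff_exp_lt (g • z).im_pos).mpr hg

theorem mem_cuspTimes_of_abs_log_im_sub_le {v : T1H} {g : SL(2, ℤ)}
    (hg : |Real.log (g • (flowH t v).base).im - min (t - p) (q - t)| ≤ c)
    (hp : p + u + c < t) (hq : t < q - u - c) : t ∈ cuspTimes (proj v) (Real.exp u) := by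
  have hmin : u + c < min (t - p) (q - t) := lt_min (by linarith) (by linarith)
  exact mem_cuspTimes_proj.mpr
    ⟨g, (Real.lt_log_iff_exp_lt (UpperHalfPlane.im_pos _)).mp (by linarith [(abs_le.mp hg).1])⟩

theorem bounds_of_mem_cuspTimes {v : T1H} {g : SL(2, ℤ)}
    (hg : |Real.log (g • (flowH t v).base).im - min (t - p) (q - t)| ≤ c)
    (hp : p ≤ t) (hq : t ≤ q) (hc : c ≤ u) (ht : t ∈ cuspTimes (proj v) (Real.exp u)) :
    p + u - c ≤ t ∧ t ≤ q - u + c := by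
  obtain ⟨γ, hγ⟩ := mem_cuspTimes_proj.mp ht
  obtain ⟨hge, hle⟩ := abs_le.mp hg
  have hmin : 0 ≤ min (t - p) (q - t) := le_min (sub_nonneg.mpr hp) (sub_nonneg.mpr hq)
  have hlog := lt_log_im_of_lt_im hγ (by linarith : -c ≤ Real.log (g • (flowH t v).base).im) hc
  have hpq := le_min_iff.mp (by linarith : u - c ≤ min (t - p) (q - t))
  constructor <;> linarith

end CuspTimes

section Pattern

variable {a b x : ℝ}

theorem returnTime_zero (a b x : ℝ) : returnTime a b x 0 = 0 := by simp [returnTime]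

theorem returnTime_one (a b x : ℝ) : returnTime a b x 1 = 0 := by simp [returnTime]

theorem returnTime_add_two (a b x : ℝ) (n : ℕ) :
    returnTime a b x (n + 2) =
      returnTime a b x (n + 1) + 2 * Real.log |completeQuotient a b x (n + 1)| := by
  rw [returnTime, Finset.sum_Ico_succ_top (by omega), mul_add, returnTime]

theorem log_abs_completeQuotient_pos (hp : (a, b) ∈ paramP) (hx : Irrational x) (n : ℕ) :
    0 < Real.log |completeQuotient a b x (n + 1)| :=
  Real.log_pos (one_lt_abs_completeQuotient_succ hp hx n)

theorem returnTime_mono (hp : (a, b) ∈ paramP) (hx : Irrational x) : Monotone (returnTime a b x) :=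
  monotone_nat_of_le_succ fun
    | 0 => (returnTime_zero a b x).trans_le (returnTime_one a b x).ge
    | n + 1 => by linarith [returnTime_add_two a b x n, log_abs_completeQuotient_pos hp hx n]

theorem returnTime_add_le (hp : (a, b) ∈ paramP) (hx : Irrational x) (n : ℕ) :
    returnTime a b x n + 2 * Real.log (1 + margin a b) ≤ returnTime a b x (n + 3) := by
  have htwo (n : ℕ) : returnTime a b x (n + 1) + 2 * Real.log (1 + margin a b) ≤
      returnTime a b x (n + 3) := by
    have hlog := Real.log_le_log (by linarith [margin_pos hp]) (one_add_margin_le_abs_mul hp hx n)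
    rw [abs_mul, Real.log_mul (abs_ne_zero.mpr (irrational_completeQuotient hx _).ne_zero)
      (abs_ne_zero.mpr (irrational_completeQuotient hx _).ne_zero)] at hlog
    linarith [returnTime_add_two a b x n, returnTime_add_two a b x (n + 1)]
  linarith [htwo n, returnTime_mono hp hx n.le_succ]

theorem abs_log_completeQuotient_sub_le (hp : (a, b) ∈ paramP) (hx : Irrational x) (n : ℕ) :
    |Real.log |completeQuotient a b x (n + 1)| -
      Real.log (|(partialQuotient a b x (n + 1) : ℝ)|)| ≤ Real.log 2 := by
  have hy := one_pos.trans (one_lt_abs_completeQuotient_succ hp hx n)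
  have hk := one_pos.trans_le (one_le_abs_partialQuotient hp hx n)
  have h₁ := Real.log_le_log hy (abs_completeQuotient_le hp hx n)
  have h₂ := Real.log_le_log hk (abs_partialQuotient_le hp hx n)
  rw [Real.log_mul two_ne_zero (by positivity)] at h₁ h₂
  exact abs_le.mpr ⟨by linarith, by linarith⟩

theorem abs_returnTime_step_le (hp : (a, b) ∈ paramP) (hx : Irrational x) (n : ℕ) :
    |returnTime a b x (n + 1) - returnTime a b x n -
      2 * Real.log (|(partialQuotient a b x n : ℝ)|)| ≤
      2 * Real.log 2 + 2 * Real.log |(partialQuotient a b x 0 : ℝ)| := by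
  have h₀ : 0 ≤ Real.log |(partialQuotient a b x 0 : ℝ)| := by
    rw [Real.log_abs]
    exact Real.log_intCast_nonneg _
  have h₂ := Real.log_pos one_lt_two
  cases n with
  | zero =>
    rw [returnTime_one, returnTime_zero, sub_zero, zero_sub, abs_neg, abs_of_nonneg (by positivity)]
    linarith
  | succ n =>
    rw [returnTime_add_two, add_sub_cancel_left, ← mul_sub, abs_mul, abs_two]
    linarith [abs_log_completeQuotient_sub_le hp hx n]

theorem exists_excursionPattern (hp : (a, b) ∈ paramP) (hx : Irrational x) {v : T1H}
    (hv : IsAttractingEndpoint v x) :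
    ∃ C, ExcursionPattern (fun u ↦ cuspTimes (proj v) (Real.exp u)) (returnTime a b x)
      (fun n ↦ Real.log |(partialQuotient a b x n : ℝ)|) C (2 * Real.log (1 + margin a b)) := by
  obtain ⟨H, hH⟩ := exists_abs_log_im_convMatrix_smul_flowH_sub_le hp hx hv
  have hH₀ : 0 ≤ H := (abs_nonneg _).trans (hH 0 0 le_rfl)
  set S := 2 * Real.log 2 + 2 * Real.log |(partialQuotient a b x 0 : ℝ)|
  have hS₀ : 0 ≤ S := (abs_nonneg _).trans (abs_returnTime_step_le hp hx 0)
  have hpos (n : ℕ) : 0 ≤ returnTime a b x n :=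
    returnTime_zero a b x ▸ returnTime_mono hp hx n.zero_le
  exact ⟨H + S,
    { measurableSet := fun u ↦ (isOpen_cuspTimes _ _).measurableSet
      const_nonneg := add_nonneg hH₀ hS₀
      rate_pos := mul_pos two_pos (Real.log_pos (by linarith [margin_pos hp]))
      time_zero := returnTime_zero a b x
      time_mono := returnTime_mono hp hx
      time_step := fun n ↦ (abs_returnTime_step_le hp hx n).trans (le_add_of_nonneg_left hH₀)
      time_growth := returnTime_add_le hp hx
      mem_of_lt := fun
        | 0, hu, h₁, h₂ => by
          rw [returnTime_zero] at h₁
          rw [returnTime_one] at h₂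
          linarith
        | n + 1, hu, h₁, h₂ => mem_cuspTimes_of_abs_log_im_sub_le
          (hH n _ (by linarith [hpos (n + 1)])) (by linarith) (by linarith)
      bounds_of_mem := fun
        | 0, _, hs, _ => by
          rw [returnTime_zero, returnTime_one] at hs
          exact absurd hs.1 hs.2.not_gt
        | n + 1, hu, hs, hmem => by
          have hbounds := bounds_of_mem_cuspTimes (hH n _ ((hpos (n + 1)).trans hs.1.le)) hs.1.le
            hs.2 (by linarith) hmem
          constructor <;> linarith [hbounds.1, hbounds.2] }⟩

end Pattern

section LogAverages

variable {a b x r : ℝ}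

theorem log_abs_modifiedQuotient_exp (a b x : ℝ) (hr : 0 < r) (j : ℕ) :
    Real.log |(modifiedQuotient a b x (Real.exp r) j : ℝ)| =
      if r < Real.log |(partialQuotient a b x j : ℝ)| then
        Real.log |(partialQuotient a b x j : ℝ)| else 0 := by
  have hiff : Real.exp r < |(partialQuotient a b x j : ℝ)| ↔
      r < Real.log |(partialQuotient a b x j : ℝ)| := by
    rcases (abs_nonneg (partialQuotient a b x j : ℝ)).eq_or_lt with h | h
    · rw [← h, Real.log_zero]
      exact iff_of_false (Real.exp_pos r).not_gt hr.not_gt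
    · exact (Real.lt_log_iff_exp_lt h).symm
  rw [modifiedQuotient, apply_ite (fun k : ℤ ↦ Real.log |(k : ℝ)|)]
  simp only [hiff, Int.cast_one, abs_one, Real.log_one]

theorem tendsto_modifiedLogAverage_exp_iff (a b x : ℝ) (hr : 0 < r) :
    Tendsto (modifiedLogAverage a b x (Real.exp r)) atTop (𝓝 0) ↔
      largeSum (fun j ↦ Real.log |(partialQuotient a b x j : ℝ)|) r =o[atTop]
        (Nat.cast : ℕ → ℝ) := by
  rw [isLittleO_iff_tendsto' ((eventually_gt_atTop 0).mono fun N hN h ↦ by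
    simp_all [hN.ne'])]
  refine tendsto_congr fun N ↦ ?_
  rw [modifiedLogAverage, one_div_mul_eq_div, largeSum]
  simp only [log_abs_modifiedQuotient_exp a b x hr]

theorem natCast_isLittleO_iff_tendsto_atTop {f : ℕ → ℝ} (hf : ∀ n, 0 ≤ f n) :
    (Nat.cast : ℕ → ℝ) =o[atTop] f ↔ Tendsto (fun N : ℕ ↦ 1 / (N : ℝ) * f N) atTop atTop := by
  have hnorm (N : ℕ) : ‖1 / (N : ℝ) * f N‖ = 1 / (N : ℝ) * f N :=
    Real.norm_of_nonneg (mul_nonneg (by positivity) (hf N))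
  have hne : ∀ᶠ N : ℕ in atTop, (N : ℝ) ≠ 0 :=
    (eventually_ne_atTop 0).mono fun N ↦ Nat.cast_ne_zero.mpr
  refine Iff.trans ?_ ((isLittleO_one_left_iff ℝ).trans (tendsto_congr hnorm))
  constructor <;> intro h
  · refine ((isBigO_refl (fun N : ℕ ↦ 1 / (N : ℝ)) atTop).mul_isLittleO h).congr' ?_ .rfl
    filter_upwards [hne] with N hN using one_div_mul_cancel hN
  · refine ((isBigO_refl (Nat.cast : ℕ → ℝ) atTop).mul_isLittleO h).congr' ?_ ?_
    · exact .of_forall fun N ↦ mul_one _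
    · filter_upwards [hne] with N hN
      rw [← mul_assoc, mul_one_div_cancel hN, one_mul]

theorem tendsto_logAverage_atTop_iff (a b x : ℝ) :
    Tendsto (logAverage a b x) atTop atTop ↔ (Nat.cast : ℕ → ℝ) =o[atTop]
      fun N ↦ ∑ j ∈ Finset.range N, Real.log |(partialQuotient a b x j : ℝ)| :=
  (natCast_isLittleO_iff_tendsto_atTop fun N ↦ Finset.sum_nonneg fun j _ ↦ by
    rw [Real.log_abs]
    exact Real.log_intCast_nonneg _).symm

end LogAverages

end CuspExcursion

end

theorem theorem1p3_general {a b : ℝ} (hp : (a, b) ∈ paramP) {v : T1H} {x : ℝ} (hirr : Irrational x)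
    (hx : IsAttractingEndpoint v x) :
    (VisitsCuspWithFreqZero (proj v) ↔
      ∃ ξ : ℝ, 1 < ξ ∧ Filter.Tendsto (modifiedLogAverage a b x ξ) Filter.atTop (nhds 0)) ∧
    (VisitsCuspWithFreqOne (proj v) ↔
      Filter.Tendsto (logAverage a b x) Filter.atTop Filter.atTop) := by
  obtain ⟨C, hpattern⟩ := exists_excursionPattern hp hirr hx
  constructor
  · rw [visitsCuspWithFreqZero_iff, hpattern.exists_occupationTime_isLittleO_iff,
      exists_one_lt_iff_exp]
    exact exists_congr fun r ↦ and_congr_right fun hr ↦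
      (tendsto_modifiedLogAverage_exp_iff a b x hr).symm
  · rw [visitsCuspWithFreqOne_iff, hpattern.forall_sub_occupationTime_isLittleO_iff,
      tendsto_logAverage_atTop_iff]

theorem theorem1p3 (a b : ℝ) (hab : (a, b) ∈ paramS)
    (v : T1M) (vtilde : T1H) (hlift : proj vtilde = v)
    (x : ℝ) (hirr : Irrational x) (hx : IsAttractingEndpoint vtilde x) :
    (VisitsCuspWithFreqZero v ↔
      ∃ ξ : ℝ, 1 < ξ ∧
        Filter.Tendsto (fun N : ℕ => modifiedLogAverage a b x ξ N) Filter.atTop (nhds 0)) ∧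
    (VisitsCuspWithFreqOne v ↔
      Filter.Tendsto (fun N : ℕ => logAverage a b x N) Filter.atTop Filter.atTop) :=
  hlift ▸ theorem1p3_general hab.1 hirr hx
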